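/- Let $F$ and $G$ be finite groups, let $G$ act transitively on nonempty finite sets $X$ and $Z$, and let $F$ act transitively on a nonempty finite set $Y$. For a finite set $A$ let $L(A)$ be the space of all functions $A\to\mathbb{C}$ with $\langle f_1,f_2\rangle=\sum_{a\in A} f_1(a)\overline{f_2(a)}$; a group acting on $A$ acts on $L(A)$ by $(gf)(a)=f(g^{-1}a)$. The wreath product $F\wr G=F^X\rtimes G$ (with $(gf)(x)=f(g^{-1}x)$ for $f\in F^X$) acts on $Y^X\times Z$ by $(f,g)(\varphi,z)=(\varphi',gz)$, where $\varphi'(x)=f(x)\varphi(g^{-1}x)$. Suppose that $L(Y)$ is multiplicity free, and let $L(Y)=\bigoplus_{k=0}^n V_k$ be its decomposition into irreducible, pairwise inequivalent $F$-subrepresentations; let $\sigma_k$ denote the representation of $F$ on $V_k$. Fix a function $h:X\to\{0,\dots,n\}$ and let $I=\{g\in G: h(gx)=h(x)\ \forall x\in X\}$ be its stabilizer in $G$. For $s\in G$ let $(sh)(x)=h(s^{-1}x)$. For any function $h':X\to\{0,\dots,n\}$ let $V_{h'}=\bigotimes_{x\in X}V_{h'(x)}\subseteq L(Y^X)$ be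 the span of the functions $\varphi\mapsto\prod_{x\in X}v_x(\varphi(x))$ with $v_x\in V_{h'(x)}$. Let $\widetilde\sigma$ be the representation of $F\wr I=\{(f,g)\in F\wr G: g\in I\}$ on $\bigotimes_{x\in X}V_{h(x)}$ given by $\widetilde\sigma(f,g)\bigl(\bigotimes_{x} v_x\bigr)=\bigotimes_{x}\sigma_{h(g^{-1}x)}(f(x))v_{g^{-1}x}$. Let $\eta$ be an irreducible complex representation of $I$, and let $\overline\eta(f,g)=\eta(g)$ be its inflation to $F\wr I$. Let $U_1\oplus\cdots\oplus U_m$ be an orthogonal decomposition of the $\eta$-isotypic component of $L(Z)$, regarded as a representation of $I$, into irreducible subrepresentations equivalent to $\eta$. Let $S\subseteq G$ be a system of representatives for the cosets of $I$ in $G$, that is, $G=\coprod_{s\in S}sI$. For $i=1,\dots,m$ set $$W_i=\bigoplus_{s\in S}\bigl(V_{sh}\otimes sU_i\bigr)\subseteq L(Y^X\times Z),$$ where $V_{sh}\otimes sU_i$ is the span of the functions $(\varphi,z)\mapsto a(\varphi)b(z)$ with $a\in V_{sh}$ and $b\in sU_i$. Then, for each $i$, the summands $V_{sh}\otimes sU_i$,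 $s\in S$, are pairwise orthogonal, and $W_i$ is $F\wr G$-invariant, irreducible and equivalent to $\mathrm{Ind}_{F\wr I}^{F\wr G}(\widetilde\sigma\otimes\overline\eta)$. Moreover, the $W_i$ are pairwise orthogonal and $W_1\oplus\cdots\oplus W_m$ is the $\mathrm{Ind}_{F\wr I}^{F\wr G}(\widetilde\sigma\otimes\overline\eta)$-isotypic component of $L(Y^X\times Z)$. Consequently the multiplicity of $\mathrm{Ind}_{F\wr I}^{F\wr G}(\widetilde\sigma\otimes\overline\eta)$ in the $F\wr G$-representation $L(Y^X\times Z)$ equals the multiplicity of $\eta$ in the $I$-representation $L(Z)$; both are equal to $m$. -/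

import Mathlib

open scoped TensorProduct

noncomputable section

/-- The permutation representation `λ` of `G` on `L(X) = X → ℂ`: `(λ(g) f)(x) = f(g⁻¹ x)`. -/
def permRep (G X : Type*) [Group G] [MulAction G X] : Representation ℂ G (X → ℂ) where
  toFun g :=
    { toFun := fun f x => f (g⁻¹ • x)
      map_add' := fun _ _ => rfl
      map_smul' := fun _ _ => rfl }
  map_one' := by ext; simp
  map_mul' a b := by ext; simp [mul_smul]

/-- Orthogonality of two subspaces of `L(X)` for the scalar product
`⟨f₁, f₂⟩ = ∑ x, f₁ x * conj (f₂ x)`. -/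
def OrthogonalSubspaces {X : Type*} [Fintype X] (A B : Submodule ℂ (X → ℂ)) : Prop :=
  ∀ f₁ ∈ A, ∀ f₂ ∈ B, ∑ x, f₁ x * (starRingEnd ℂ) (f₂ x) = 0

section Representations

variable {G : Type*} [Group G] {V W : Type*} [AddCommGroup V] [Module ℂ V]
  [AddCommGroup W] [Module ℂ W]

/-- The `ρ`-isotypic component of `τ`: the sum of all subrepresentations of `τ` that are
equivalent to `ρ` (used for irreducible `ρ`). -/
def isotypicPart (τ : Representation ℂ G V) (ρ : Representation ℂ G W) : Submodule ℂ V :=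
  ⨆ (A : Subrepresentation τ) (_ : Nonempty (A.toRepresentation.Equiv ρ)), A.toSubmodule

/-- `τ` is the (internal) direct sum of the irreducible subrepresentations `A 0, …, A (n - 1)`. -/
def IsIrreducibleDecomposition (τ : Representation ℂ G V) {n : ℕ}
    (A : Fin n → Subrepresentation τ) : Prop :=
  (∀ i, (A i).toRepresentation.IsIrreducible) ∧
    DirectSum.IsInternal fun i => (A i).toSubmodule

/-- The irreducible representation `ρ` has multiplicity `k` in `τ`: `τ` is a direct sum of
irreducible subrepresentations, and every such decomposition has exactly `k` summands equivalent
to `ρ`. -/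
def HasMultiplicity (τ : Representation ℂ G V) (ρ : Representation ℂ G W) (k : ℕ) : Prop :=
  (∃ (n : ℕ) (A : Fin n → Subrepresentation τ), IsIrreducibleDecomposition τ A) ∧
    ∀ (n : ℕ) (A : Fin n → Subrepresentation τ), IsIrreducibleDecomposition τ A →
      Nat.card {i : Fin n // Nonempty ((A i).toRepresentation.Equiv ρ)} = k

/-- For a representation `τ` on `L(X)`, the subrepresentations `A i` are irreducible, equivalent
to `ρ`, pairwise orthogonal, and their sum is the `ρ`-isotypic component of `τ`. -/
def IsOrthogonalIsotypicDecomposition {X : Type*} [Fintype X]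
    (τ : Representation ℂ G (X → ℂ)) (ρ : Representation ℂ G W)
    {m : ℕ} (A : Fin m → Subrepresentation τ) : Prop :=
  (∀ i, (A i).toRepresentation.IsIrreducible) ∧
  (∀ i, Nonempty ((A i).toRepresentation.Equiv ρ)) ∧
  (∀ i j, i ≠ j → OrthogonalSubspaces (A i).toSubmodule (A j).toSubmodule) ∧
  (⨆ i, (A i).toSubmodule) = isotypicPart τ ρ

end Representations

/-- The wreath product `F ≀ G = F^X ⋊ G`, where `G` acts on `F^X` by `(g f)(x) = f(g⁻¹ x)`. -/
abbrev WreathProduct (F G X : Type*) [Group F] [Group G] [MulAction G X] : Type _ :=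
  (X → F) ⋊[(mulAutArrow : G →* MulAut (X → F))] G

section Wreath

variable {F G X : Type*} [Group F] [Group G] [MulAction G X]

/-- The action of `F ≀ G` on `Y^X × Z`, the product of the exponentiation and of the inflation:
`(f, g) (φ, z) = (x ↦ f(x) φ(g⁻¹ x), g z)`. -/
instance wreathAction {Y Z : Type*} [MulAction F Y] [MulAction G Z] :
    MulAction (WreathProduct F G X) ((X → Y) × Z) where
  smul w p := (fun x => w.left x • p.1 (w.right⁻¹ • x), w.right • p.2)
  one_smul p := by
    refine Prod.ext (funext fun x => ?_) ?_
    · change (1 : F) • p.1 ((1 : G)⁻¹ • x) = p.1 x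
      simp
    · exact one_smul G p.2
  mul_smul a b p := by
    refine Prod.ext (funext fun x => ?_) ?_
    · change (a.left x * b.left (a.right⁻¹ • x)) • p.1 ((a.right * b.right)⁻¹ • x) =
        a.left x • b.left (a.right⁻¹ • x) • p.1 (b.right⁻¹ • a.right⁻¹ • x)
      simp [mul_smul]
    · exact mul_smul a.right b.right p.2

/-- The stabilizer `I` in `G` of a function `h` on `X`. -/
def typeStabilizer (G : Type*) {X κ : Type*} [Group G] [MulAction G X] (h : X → κ) :
    Subgroup G where
  carrier := {g | ∀ x, h (g • x) = h x}
  one_mem' := by simp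
  mul_mem' := by
    intro a b ha hb x
    rw [mul_smul, ha, hb]
  inv_mem' := by
    intro a ha x
    have := ha (a⁻¹ • x)
    rw [smul_inv_smul] at this
    exact this.symm

theorem typeStabilizer_inv_smul {κ : Type*} {h : X → κ} {g : G}
    (hg : g ∈ typeStabilizer G h) (x : X) : h (g⁻¹ • x) = h x :=
  (typeStabilizer G h).inv_mem hg x

/-- The subgroup `F ≀ I = {(f, g) : g ∈ I}` of `F ≀ G`. -/
def wreathSubgroup (F X : Type*) {G : Type*} [Group F] [Group G] [MulAction G X]
    (I : Subgroup G) : Subgroup (WreathProduct F G X) :=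
  I.comap SemidirectProduct.rightHom

theorem wreathSubgroup_inv_smul {κ : Type*} {h : X → κ}
    (w : wreathSubgroup F X (typeStabilizer G h)) (x : X) : h (w.1.right⁻¹ • x) = h x :=
  typeStabilizer_inv_smul (g := w.1.right) w.2 x

/-- The projection `F ≀ I → I`. -/
def wreathSubgroupProj (F X : Type*) {G : Type*} [Group F] [Group G] [MulAction G X]
    (I : Subgroup G) : wreathSubgroup F X I →* I :=
  (SemidirectProduct.rightHom.comp (wreathSubgroup F X I).subtype).codRestrict I fun w => w.2

/-- The inflation `η̄` of a representation `η` of `I` to `F ≀ I`: `η̄(f, g) = η(g)`. -/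
def inflation (F X : Type*) {G : Type*} [Group F] [Group G] [MulAction G X]
    {I : Subgroup G} {U : Type*} [AddCommGroup U] [Module ℂ U] (η : Representation ℂ I U) :
    Representation ℂ (wreathSubgroup F X I) U :=
  η.comp (wreathSubgroupProj F X I)

section Extension

variable {κ : Type*} {V : κ → Type*} [∀ i, AddCommGroup (V i)] [∀ i, Module ℂ (V i)]

/-- The operator `⨂ v_x ↦ ⨂ σ_{h(g⁻¹ x)}(f(x)) v_{g⁻¹ x}`; the cast identifies `V (h (g⁻¹ x))`
with `V (h x)`. -/
def extensionMap (σ : ∀ i, Representation ℂ F (V i)) (h : X → κ)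
    (w : wreathSubgroup F X (typeStabilizer G h)) :
    (⨂[ℂ] x, V (h x)) →ₗ[ℂ] (⨂[ℂ] x, V (h x)) :=
  (PiTensorProduct.map fun x =>
    (LinearEquiv.cast (R := ℂ) (M := V)
      (wreathSubgroup_inv_smul w x : h ((MulAction.toPerm w.1.right).symm x) = h x)).toLinearMap ∘ₗ
      σ (h ((MulAction.toPerm w.1.right).symm x)) (w.1.left x)) ∘ₗ
    (PiTensorProduct.reindex ℂ (fun x => V (h x))
      (MulAction.toPerm w.1.right : Equiv.Perm X)).toLinearMap

theorem extensionMap_tprod (σ : ∀ i, Representation ℂ F (V i)) (h : X → κ)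
    (w : wreathSubgroup F X (typeStabilizer G h)) (v : ∀ x, V (h x)) :
    extensionMap σ h w (PiTensorProduct.tprod ℂ v) =
      PiTensorProduct.tprod ℂ fun x =>
        cast (congrArg V (wreathSubgroup_inv_smul w x))
          (σ (h (w.1.right⁻¹ • x)) (w.1.left x) (v (w.1.right⁻¹ • x))) := by
  unfold extensionMap
  rw [LinearMap.comp_apply, LinearEquiv.coe_coe, PiTensorProduct.reindex_tprod,
    PiTensorProduct.map_tprod]
  rfl

theorem rep_apply_cast (σ : ∀ i, Representation ℂ F (V i)) {i j : κ} (e : i = j) (f : F)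
    (v : V i) : σ j f (cast (congrArg V e) v) = cast (congrArg V e) (σ i f v) := by
  subst e
  rfl

theorem cast_rep_congr (σ : ∀ i, Representation ℂ F (V i)) {h : X → κ} (v : ∀ x, V (h x))
    {y z : X} (e : y = z) {k : κ} (hy : h y = k) (hz : h z = k) (f : F) :
    cast (congrArg V hy) (σ (h y) f (v y)) = cast (congrArg V hz) (σ (h z) f (v z)) := by
  subst e
  rfl

/-- The extension `σ̃` of `⨂ σ_{h(x)}` to `F ≀ I`, where `I` is the stabilizer of `h`:
`σ̃(f, g) (⨂ v_x) = ⨂ σ_{h(g⁻¹ x)}(f(x)) v_{g⁻¹ x}`. -/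
def extension (σ : ∀ i, Representation ℂ F (V i)) (h : X → κ) :
    Representation ℂ (wreathSubgroup F X (typeStabilizer G h)) (⨂[ℂ] x, V (h x)) where
  toFun := extensionMap σ h
  map_one' := by
    refine PiTensorProduct.ext (MultilinearMap.ext fun v => ?_)
    change extensionMap σ h 1 (PiTensorProduct.tprod ℂ v) = PiTensorProduct.tprod ℂ v
    rw [extensionMap_tprod]
    congr 1
    funext x
    refine (cast_rep_congr σ v (z := x) (by simp) (wreathSubgroup_inv_smul 1 x) rfl _).trans ?_
    change σ (h x) 1 (v x) = v x
    simp
  map_mul' a b := by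
    refine PiTensorProduct.ext (MultilinearMap.ext fun v => ?_)
    change extensionMap σ h (a * b) (PiTensorProduct.tprod ℂ v) =
      extensionMap σ h a (extensionMap σ h b (PiTensorProduct.tprod ℂ v))
    rw [extensionMap_tprod, extensionMap_tprod, extensionMap_tprod]
    congr 1
    funext x
    rw [rep_apply_cast σ (wreathSubgroup_inv_smul b (a.1.right⁻¹ • x)), cast_cast,
      ← Module.End.mul_apply, ← map_mul]
    exact cast_rep_congr σ v (by simp [mul_smul]) (wreathSubgroup_inv_smul (a * b) x)
      ((wreathSubgroup_inv_smul b _).trans (wreathSubgroup_inv_smul a x)) _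

end Extension

/-- The induced representation `Ind_{F≀I}^{F≀G}(σ̃ ⊗ η̄)`. -/
def inducedRep {κ : Type*} {V : κ → Type*} [∀ i, AddCommGroup (V i)] [∀ i, Module ℂ (V i)]
    (σ : ∀ i, Representation ℂ F (V i)) (h : X → κ)
    {U : Type*} [AddCommGroup U] [Module ℂ U] (η : Representation ℂ (typeStabilizer G h) U) :=
  Representation.ind (wreathSubgroup F X (typeStabilizer G h)).subtype
    ((extension σ h).tprod (inflation F X η))

end Wreath

/-- The subspace `V_h = ⨂ V_{h(x)}` of `L(Y^X)`, spanned by the products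
`φ ↦ ∏ x, v_x (φ x)` with `v_x ∈ V_{h(x)}`. -/
def typeSubspace {X Y κ : Type*} [Fintype X] (V : κ → Submodule ℂ (Y → ℂ)) (h : X → κ) :
    Submodule ℂ ((X → Y) → ℂ) :=
  Submodule.span ℂ {ψ | ∃ v : X → Y → ℂ, (∀ x, v x ∈ V (h x)) ∧ ψ = fun φ => ∏ x, v x (φ x)}

/-- For `A ≤ L(P)` and `B ≤ L(Z)`, the subspace `A ⊗ B` of `L(P × Z)`, spanned by the functions
`(p, z) ↦ a(p) b(z)`. -/
def tensorSubspace {P Z : Type*} (A : Submodule ℂ (P → ℂ)) (B : Submodule ℂ (Z → ℂ)) :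
    Submodule ℂ (P × Z → ℂ) :=
  Submodule.span ℂ {ψ | ∃ a ∈ A, ∃ b ∈ B, ψ = fun p => a p.1 * b p.2}

/-- The summand `V_{sh} ⊗ sB` of `L(Y^X × Z)`, where `(sh)(x) = h(s⁻¹ x)` and `sB` is the
`s`-translate of `B ≤ L(Z)`. -/
def translatedSummand {G X Y Z κ : Type*} [Fintype X] [Group G] [MulAction G X] [MulAction G Z]
    (V : κ → Submodule ℂ (Y → ℂ)) (h : X → κ) (B : Submodule ℂ (Z → ℂ)) (s : G) :
    Submodule ℂ ((X → Y) × Z → ℂ) :=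
  tensorSubspace (typeSubspace V fun x => h (s⁻¹ • x)) (B.map (permRep G Z s))

end

/-! Since `L(Y)` is multiplicity free, every rank-one operator `f ↦ ⟨f, v⟩ u` with `u, v` in the
same `V_k` is the action of an element of the group algebra of `F` (`exists_groupAlgebra_rankOne`).
Multiplying such elements over `X` shows that the base group `F^X` alone realises `m ↦ u ⊗ ⟨m, v⟩`,
where `u, v` are pure tensors of the same type and `⟨m, v⟩`, written `contract v m`, is a function
on `Z` (`sum_groupAlgebra_permRep`). This separates the `Y^X` factor from the `Z` factor and carries
the argument. Irreducibility: a nonzero invariant subspace of `W_i` has a nonzero contraction, which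
lies in some `sU_i`. Moved back by `s`, it gives a nonzero vector of `U_i` that may be tensored with
all of `V_h`; irreducibility of `U_i` under `I` and translation by `G` then recover all of `W_i`
(`isIrreducible_wreathSubrep`). Equivalence: by Frobenius reciprocity the inclusion of `V_h ⊗ U_i`
extends to the induced representation. Its image is `W_i` because the translates span, and it is
injective because different cosets carry different types (`nonempty_wreathSubrep_equiv_inducedRep`).
Isotypic component: an `F ≀ I`-map from `σ̃ ⊗ η̄` to `L(Y^X × Z)` must send `w ⊗ u` to `w ⊗ c` with
`c` in the `η`-isotypic component of `L(Z)` (`equivariant_map_mem`), so every copy of the induced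
representation lies in the sum of the `W_i`. The multiplicities follow by comparing dimensions. -/

noncomputable section

/-! ### Irreducibility, Schur's lemma and multiplicities. -/

section General

variable {G : Type*} [Group G] {V W : Type*} [AddCommGroup V] [Module ℂ V]
  [AddCommGroup W] [Module ℂ W]

/-- A criterion phrased with invariant subspaces of the ambient space, which avoids
subrepresentations of a subrepresentation. -/
theorem isIrreducible_of_forall_submodule {τ : Representation ℂ G V} (A : Subrepresentation τ)
    (hne : A.toSubmodule ≠ ⊥)
    (hA : ∀ M : Submodule ℂ V, M ≤ A.toSubmodule → (∀ g, ∀ x ∈ M, τ g x ∈ M) → M ≠ ⊥ →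
      A.toSubmodule ≤ M) :
    A.toRepresentation.IsIrreducible := by
  have hnt : Nontrivial (Subrepresentation A.toRepresentation) := by
    refine ⟨⊥, ⊤, fun he => hne ?_⟩
    have h1 : (⊥ : Submodule ℂ A.toSubmodule) = ⊤ := congrArg Subrepresentation.toSubmodule he
    rw [eq_bot_iff]
    intro x hx
    have : (⟨x, hx⟩ : A.toSubmodule) ∈ (⊥ : Submodule ℂ A.toSubmodule) := h1 ▸ trivial
    simpa using this
  refine { hnt with eq_bot_or_eq_top := fun B => ?_ }
  by_cases hB : B.toSubmodule = ⊥
  · exact Or.inl (Subrepresentation.toSubmodule_injective hB)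
  · refine Or.inr (Subrepresentation.toSubmodule_injective (eq_top_iff.2 ?_))
    have := hA (B.toSubmodule.map A.toSubmodule.subtype) (Submodule.map_subtype_le _ _) ?_ ?_
    · intro x _
      obtain ⟨y, hy, hyx⟩ := this x.2
      rwa [← Subtype.ext (a1 := y) (a2 := x) hyx]
    · rintro g _ ⟨y, hy, rfl⟩
      exact ⟨_, B.apply_mem_toSubmodule g hy, rfl⟩
    · intro h0
      exact hB (Submodule.map_injective_of_injective A.toSubmodule.injective_subtype
        (h0.trans (Submodule.map_bot _).symm))

theorem le_of_isIrreducible {τ : Representation ℂ G V} (A : Subrepresentation τ)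
    (hA : A.toRepresentation.IsIrreducible) {M : Submodule ℂ V}
    (hM : ∀ g, ∀ x ∈ M, x ∈ A.toSubmodule → τ g x ∈ M)
    {x : V} (hx : x ∈ M) (hxA : x ∈ A.toSubmodule) (hx0 : x ≠ 0) : A.toSubmodule ≤ M := by
  let B : Subrepresentation A.toRepresentation :=
    ⟨M.comap A.toSubmodule.subtype, fun g y hy => hM g y.1 hy y.2⟩
  rcases hA.eq_bot_or_eq_top B with h | h
  · have h1 : (⟨x, hxA⟩ : A.toSubmodule) ∈ B.toSubmodule := hx
    rw [h] at h1
    exact absurd (congrArg Subtype.val ((Submodule.mem_bot ℂ).1 h1)) hx0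
  · intro y hy
    have h1 : (⟨y, hy⟩ : A.toSubmodule) ∈ B.toSubmodule := h ▸ trivial
    exact h1

theorem ne_bot_of_isIrreducible {τ : Representation ℂ G V} (A : Subrepresentation τ)
    (hA : A.toRepresentation.IsIrreducible) : A.toSubmodule ≠ ⊥ := by
  intro h
  apply (bot_ne_top : (⊥ : Subrepresentation A.toRepresentation) ≠ ⊤)
  apply Subrepresentation.toSubmodule_injective
  have : Subsingleton A.toSubmodule := (Submodule.subsingleton_iff_eq_bot).2 h
  exact Subsingleton.elim _ _

/-- Schur's lemma for a linear map that intertwines on a subrepresentation. -/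
theorem eq_zero_of_not_equiv {τ : Representation ℂ G V} {ρ : Representation ℂ G W}
    (A : Subrepresentation τ) (B : Subrepresentation ρ)
    (hA : A.toRepresentation.IsIrreducible) (hB : B.toRepresentation.IsIrreducible)
    (hAB : ¬ Nonempty (A.toRepresentation.Equiv B.toRepresentation))
    (f : V →ₗ[ℂ] W) (hf : ∀ g, ∀ x ∈ A.toSubmodule, f (τ g x) = ρ g (f x))
    (hfB : ∀ x ∈ A.toSubmodule, f x ∈ B.toSubmodule) {x : V} (hx : x ∈ A.toSubmodule) :
    f x = 0 := by
  have : IsEmpty (A.toRepresentation.Equiv B.toRepresentation) := not_nonempty_iff.1 hAB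
  let F : A.toRepresentation.IntertwiningMap B.toRepresentation :=
    ⟨f.restrict hfB, fun g => by
      ext y
      exact hf g y.1 y.2⟩
  have h0 : F = 0 := Subsingleton.elim _ _
  have : F ⟨x, hx⟩ = 0 := by rw [h0]; rfl
  exact congrArg Subtype.val this

theorem exists_eq_smul_of_isIrreducible [FiniteDimensional ℂ V] {τ : Representation ℂ G V}
    (A : Subrepresentation τ) (hA : A.toRepresentation.IsIrreducible)
    (f : V →ₗ[ℂ] V) (hf : ∀ g, ∀ x ∈ A.toSubmodule, f (τ g x) = τ g (f x))
    (hfA : ∀ x ∈ A.toSubmodule, f x ∈ A.toSubmodule) :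
    ∃ c : ℂ, ∀ x ∈ A.toSubmodule, f x = c • x := by
  let F : A.toRepresentation.IntertwiningMap A.toRepresentation :=
    ⟨f.restrict hfA, fun g => by
      ext y
      exact hf g y.1 y.2⟩
  obtain ⟨c, hc⟩ :=
    (Representation.IsIrreducible.algebraMap_intertwiningMap_bijective_of_isAlgClosed
      (k := ℂ) (ρ := A.toRepresentation)).2 F
  refine ⟨c, fun x hx => ?_⟩
  have : (algebraMap ℂ (A.toRepresentation.IntertwiningMap A.toRepresentation) c) ⟨x, hx⟩
    = F ⟨x, hx⟩ := by rw [hc]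
  exact (congrArg Subtype.val this).symm

theorem nonempty_equiv_of_injective {τ : Representation ℂ G V} {ρ : Representation ℂ G W}
    (A : Subrepresentation τ) (f : W →ₗ[ℂ] V) (hf : ∀ g x, f (ρ g x) = τ g (f x))
    (hinj : Function.Injective f) (hrange : LinearMap.range f = A.toSubmodule) :
    Nonempty (A.toRepresentation.Equiv ρ) := by
  let e : W ≃ₗ[ℂ] A.toSubmodule :=
    (LinearEquiv.ofInjective f hinj).trans (LinearEquiv.ofEq _ _ hrange)
  refine ⟨(Representation.Equiv.mk (σ := A.toRepresentation) (ρ := ρ) e fun g => ?_).symm⟩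
  ext x
  exact hf g x

theorem range_le_isotypicPart {τ : Representation ℂ G V} {ρ : Representation ℂ G W}
    (hρ : ρ.IsIrreducible) (f : W →ₗ[ℂ] V) (hf : ∀ g x, f (ρ g x) = τ g (f x)) :
    LinearMap.range f ≤ isotypicPart τ ρ := by
  let F : ρ.IntertwiningMap τ := ⟨f, fun g => by ext x; exact hf g x⟩
  rcases Representation.IsIrreducible.injective_or_eq_zero F with h | h
  · let A : Subrepresentation τ := ⟨LinearMap.range f, by
      rintro g _ ⟨x, rfl⟩
      exact ⟨ρ g x, hf g x⟩⟩
    exact le_iSup₂_of_le A (nonempty_equiv_of_injective A f hf h rfl) le_rfl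
  · have : f = 0 := congrArg Representation.IntertwiningMap.toLinearMap h
    rw [this, LinearMap.range_zero]
    exact bot_le

theorem finrank_iSup_of_iSupIndep [FiniteDimensional ℂ V] {ι : Type*} [Fintype ι]
    (A : ι → Submodule ℂ V) (hA : iSupIndep A) :
    Module.finrank ℂ (⨆ i, A i : Submodule ℂ V) = ∑ i, Module.finrank ℂ (A i) := by
  classical
  rw [Submodule.iSup_eq_range_dfinsupp_lsum,
    LinearMap.finrank_range_of_inj hA.dfinsupp_lsum_injective]
  exact Module.finrank_directSum _ _

theorem iSup_le_isotypicPart {τ : Representation ℂ G V} {ρ : Representation ℂ G W} {ι : Type*}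
    (B : ι → Subrepresentation τ) (hB : ∀ i, Nonempty ((B i).toRepresentation.Equiv ρ)) :
    ⨆ i, (B i).toSubmodule ≤ isotypicPart τ ρ :=
  iSup_le fun i => le_iSup₂_of_le (B i) (hB i) le_rfl

/-- The projections commute with the group because each summand is invariant: in `p i (τ g x)` only
the `i`-th component of `x` contributes. -/
theorem exists_equivariant_projections {τ : Representation ℂ G V} {n : ℕ}
    (A : Fin n → Subrepresentation τ) (hA : DirectSum.IsInternal fun i => (A i).toSubmodule) :
    ∃ p : Fin n → V →ₗ[ℂ] V, (∀ i x, p i x ∈ (A i).toSubmodule) ∧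
      (∀ i, ∀ x ∈ (A i).toSubmodule, p i x = x) ∧
      (∀ i j, i ≠ j → ∀ x ∈ (A j).toSubmodule, p i x = 0) ∧
      (∀ x, ∑ i, p i x = x) ∧ ∀ i g x, p i (τ g x) = τ g (p i x) := by
  classical
  let D : DirectSum.Decomposition fun i => (A i).toSubmodule := hA.chooseDecomposition
  let p : Fin n → V →ₗ[ℂ] V := fun i => (A i).toSubmodule.subtype ∘ₗ
    DirectSum.component ℂ (Fin n) (fun i => (A i).toSubmodule) i ∘ₗ
      (DirectSum.decomposeLinearEquiv fun i => (A i).toSubmodule).toLinearMap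
  have hp : ∀ i x, p i x = (DirectSum.decompose (fun i => (A i).toSubmodule) x i : V) :=
    fun _ _ => rfl
  have hmem : ∀ i x, p i x ∈ (A i).toSubmodule := fun i x => Subtype.mem _
  have hsame : ∀ i, ∀ x ∈ (A i).toSubmodule, p i x = x := fun i x hx => by
    rw [hp, DirectSum.decompose_of_mem_same (fun i => (A i).toSubmodule) hx]
  have hne : ∀ i j, i ≠ j → ∀ x ∈ (A j).toSubmodule, p i x = 0 := fun i j hij x hx => by
    rw [hp, DirectSum.decompose_of_mem_ne (fun i => (A i).toSubmodule) hx hij.symm]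
  have hsum : ∀ x, ∑ i, p i x = x := fun x => by
    conv_rhs => rw [← DirectSum.sum_support_decompose (fun i => (A i).toSubmodule) x]
    refine (Finset.sum_subset (Finset.subset_univ _) fun i _ hi => ?_).symm
    rw [hp, DFinsupp.notMem_support_iff.1 hi]
    rfl
  refine ⟨p, hmem, hsame, hne, hsum, fun i g x => ?_⟩
  conv_lhs => rw [← hsum x, map_sum, map_sum]
  rw [Finset.sum_eq_single i (fun j _ hj => hne i j hj.symm _
    ((A j).apply_mem_toSubmodule g (hmem j x))) (by simp)]
  exact hsame i _ ((A i).apply_mem_toSubmodule g (hmem i x))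

/-- By Schur's lemma the projections of `A` to summands not equivalent to `ρ` vanish. -/
theorem le_iSup_equiv_of_isIrreducible {τ : Representation ℂ G V} {ρ : Representation ℂ G W}
    {n : ℕ} (B : Fin n → Subrepresentation τ) (hB : IsIrreducibleDecomposition τ B)
    (A : Subrepresentation τ) (hA : A.toRepresentation.IsIrreducible)
    (hAρ : Nonempty (A.toRepresentation.Equiv ρ)) :
    A.toSubmodule ≤ ⨆ i : {i : Fin n // Nonempty ((B i).toRepresentation.Equiv ρ)},
      (B i).toSubmodule := by
  obtain ⟨e⟩ := hAρ
  obtain ⟨p, hmem, -, -, hsum, hp⟩ := exists_equivariant_projections B hB.2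
  intro x hx
  rw [← hsum x]
  refine Submodule.sum_mem _ fun i _ => ?_
  by_cases hi : Nonempty ((B i).toRepresentation.Equiv ρ)
  · exact Submodule.mem_iSup_of_mem (p := fun i : {i : Fin n //
      Nonempty ((B i).toRepresentation.Equiv ρ)} => (B i).toSubmodule) ⟨i, hi⟩ (hmem i x)
  · rw [eq_zero_of_not_equiv A (B i) hA (hB.1 i) (fun ⟨e'⟩ => hi ⟨e'.symm.trans e⟩) (p i)
      (fun g y _ => hp i g y) (fun y _ => hmem i y) hx]
    exact zero_mem _

/-- The summands of `B` equivalent to `ρ` also sum to the isotypic component, so both counts times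
`dim W` equal its dimension. -/
theorem card_equiv_eq_of_isotypicPart [FiniteDimensional ℂ V] {τ : Representation ℂ G V}
    {ρ : Representation ℂ G W} {m : ℕ}
    (A : Fin m → Subrepresentation τ) (hirr : ∀ i, (A i).toRepresentation.IsIrreducible)
    (hequiv : ∀ i, Nonempty ((A i).toRepresentation.Equiv ρ))
    (hind : iSupIndep fun i => (A i).toSubmodule)
    (hsup : ⨆ i, (A i).toSubmodule = isotypicPart τ ρ)
    {n : ℕ} (B : Fin n → Subrepresentation τ) (hB : IsIrreducibleDecomposition τ B) :
    Nat.card {i : Fin n // Nonempty ((B i).toRepresentation.Equiv ρ)} = m := by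
  classical
  set J := {i : Fin n // Nonempty ((B i).toRepresentation.Equiv ρ)} with hJ
  have hfin : ∀ C : Subrepresentation τ, Nonempty (C.toRepresentation.Equiv ρ) →
      Module.finrank ℂ C.toSubmodule = Module.finrank ℂ W :=
    fun C ⟨e⟩ => e.toLinearEquiv.finrank_eq
  have hBJ : ⨆ i : J, (B i).toSubmodule = isotypicPart τ ρ := by
    refine le_antisymm (iSup_le_isotypicPart (fun i : J => B i) fun i => i.2) ?_
    rw [← hsup]
    exact iSup_le fun i => le_iSup_equiv_of_isIrreducible B hB (A i) (hirr i) (hequiv i)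
  have hBind : iSupIndep fun i : J => (B i).toSubmodule :=
    hB.2.submodule_iSupIndep.comp Subtype.val_injective
  have h1 := finrank_iSup_of_iSupIndep _ hind
  have h2 := finrank_iSup_of_iSupIndep _ hBind
  rw [hsup, Finset.sum_congr rfl fun i _ => hfin _ (hequiv i)] at h1
  rw [hBJ, Finset.sum_congr rfl fun i _ => hfin _ i.2] at h2
  rw [h1] at h2
  simp only [Finset.sum_const, Finset.card_univ, Fintype.card_fin, smul_eq_mul] at h2
  rw [Nat.card_eq_fintype_card]
  have hpos : ∀ C : Subrepresentation τ, C.toRepresentation.IsIrreducible →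
      Nonempty (C.toRepresentation.Equiv ρ) → Module.finrank ℂ W ≠ 0 := fun C hC hCρ h0 => by
    rw [← hfin C hCρ] at h0
    exact ne_bot_of_isIrreducible C hC (Submodule.finrank_eq_zero.1 h0)
  -- `finrank` is also zero when `W` is infinite-dimensional. In either case no irreducible
  -- subrepresentation of `V` is equivalent to `ρ`, and both counts are zero.
  by_cases hW : Module.finrank ℂ W = 0
  · have hm : m = 0 := by
      by_contra hm
      exact hpos _ (hirr ⟨0, Nat.pos_of_ne_zero hm⟩) (hequiv _) hW
    have : IsEmpty J := ⟨fun i => hpos _ (hB.1 i) i.2 hW⟩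
    rw [hm, Fintype.card_eq_zero]
  · exact (Nat.eq_of_mul_eq_mul_right (Nat.pos_of_ne_zero hW) h2).symm

theorem exists_isIrreducibleDecomposition [Finite G] [FiniteDimensional ℂ V]
    (τ : Representation ℂ G V) :
    ∃ (n : ℕ) (A : Fin n → Subrepresentation τ), IsIrreducibleDecomposition τ A := by
  have hss : IsSemisimpleModule (MonoidAlgebra ℂ G) τ.asModule :=
    (Representation.isSemisimpleRepresentation_iff_isSemisimpleModule_asModule τ).1 inferInstance
  -- Noetherianity over the group algebra, inherited from finite dimension over `ℂ`, makes the
  -- independent family of simple submodules finite.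
  have hnoeth : IsNoetherian (MonoidAlgebra ℂ G) τ.asModule := by
    have : WellFoundedGT (Subrepresentation τ) :=
      StrictMono.wellFoundedGT (f := Subrepresentation.toSubmodule)
        fun A B hAB => lt_of_le_not_ge (fun x hx => hAB.le hx) fun hx => hAB.not_ge hx
    rw [← monotone_stabilizes_iff_noetherian, ← wellFoundedGT_iff_monotone_chain_condition]
    exact StrictMono.wellFoundedGT
      (Subrepresentation.subrepresentationSubmoduleOrderIso (ρ := τ)).symm.strictMono
  obtain ⟨s, hs, hs_sup, hsimple⟩ :=
    IsSemisimpleModule.exists_sSupIndep_sSup_simples_eq_top (MonoidAlgebra ℂ G) τ.asModule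
  have : Finite s := WellFoundedGT.finite_of_sSupIndep hs
  let e : Fin (Nat.card s) ≃ s := (Finite.equivFin s).symm
  have hint : DirectSum.IsInternal fun i => (e i).1 := by
    refine DirectSum.isInternal_submodule_of_iSupIndep_of_iSup_eq_top
      (((sSupIndep_iff _).1 hs).comp e.injective) ?_
    rw [e.iSup_comp (g := fun x : s => x.1), ← sSup_eq_iSup', hs_sup]
  refine ⟨_, fun i => Subrepresentation.ofSubmodule' (e i).1, fun i => ?_, hint⟩
  have h1 := isSimpleModule_iff_isAtom.1 (hsimple _ (e i).2)
  refine isIrreducible_of_forall_submodule _ (fun h => ?_) fun M hM hMG hM0 => ?_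
  · refine h1.1 (eq_bot_iff.2 fun x hx => ?_)
    have hx' : x ∈ (⊥ : Submodule ℂ V) := h ▸ hx
    exact hx'
  · rcases h1.le_iff.1 (show Subrepresentation.asSubmodule (ρ := τ) ⟨M, hMG⟩ ≤ (e i).1 from hM)
      with h | h
    · refine absurd (eq_bot_iff.2 fun x hx => ?_) hM0
      have hx' : x ∈ (⊥ : Submodule (MonoidAlgebra ℂ G) τ.asModule) := h ▸ hx
      exact hx'
    · exact fun x hx => h.ge hx

theorem hasMultiplicity_of_isotypicPart [Finite G] [FiniteDimensional ℂ V]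
    {τ : Representation ℂ G V} {ρ : Representation ℂ G W} {m : ℕ}
    (A : Fin m → Subrepresentation τ) (hirr : ∀ i, (A i).toRepresentation.IsIrreducible)
    (hequiv : ∀ i, Nonempty ((A i).toRepresentation.Equiv ρ))
    (hind : iSupIndep fun i => (A i).toSubmodule)
    (hsup : ⨆ i, (A i).toSubmodule = isotypicPart τ ρ) : HasMultiplicity τ ρ m :=
  ⟨exists_isIrreducibleDecomposition τ, fun _ B hB =>
    card_equiv_eq_of_isotypicPart A hirr hequiv hind hsup B hB⟩

end General

/-! ### Translation operators of a permutation representation. -/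

section PermRep

variable {X G : Type*} [Group G] [MulAction G X]

theorem permRep_inv_apply_self (g : G) (f : X → ℂ) : permRep G X g⁻¹ (permRep G X g f) = f := by
  rw [← Module.End.mul_apply, ← map_mul, inv_mul_cancel, map_one, Module.End.one_apply]

theorem permRep_self_inv_apply (g : G) (f : X → ℂ) : permRep G X g (permRep G X g⁻¹ f) = f := by
  rw [← Module.End.mul_apply, ← map_mul, mul_inv_cancel, map_one, Module.End.one_apply]

theorem permRep_mul_apply (g h : G) (f : X → ℂ) :
    permRep G X (g * h) f = permRep G X g (permRep G X h f) := by
  rw [map_mul, Module.End.mul_apply]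

end PermRep

/-! ### Orthogonality, averaging, and rank-one operators from the group algebra. -/

section Orthogonality

variable {X : Type*} [Fintype X]

theorem star_dotProduct_star_swap (a b : X → ℂ) : star (a ⬝ᵥ star b) = b ⬝ᵥ star a := by
  rw [← Matrix.star_dotProduct_star, star_star]

theorem eq_zero_of_dotProduct_star {a : X → ℂ} (h : a ⬝ᵥ star a = 0) : a = 0 := by
  open scoped ComplexOrder in exact dotProduct_self_star_eq_zero.1 h

theorem OrthogonalSubspaces.symm {A B : Submodule ℂ (X → ℂ)} (h : OrthogonalSubspaces A B) :
    OrthogonalSubspaces B A := fun b hb a ha => by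
  change b ⬝ᵥ star a = 0
  rw [← star_dotProduct_star_swap, show a ⬝ᵥ star b = 0 from h a ha b hb, star_zero]

theorem OrthogonalSubspaces.iSup_left {ι : Sort*} {A : ι → Submodule ℂ (X → ℂ)}
    {B : Submodule ℂ (X → ℂ)} (h : ∀ i, OrthogonalSubspaces (A i) B) :
    OrthogonalSubspaces (⨆ i, A i) B := fun a ha b hb => by
  change a ⬝ᵥ star b = 0
  induction ha using Submodule.iSup_induction' with
  | mem i x hx => exact h i x hx b hb
  | zero => exact zero_dotProduct _
  | add x y _ _ hx hy => rw [add_dotProduct, hx, hy, add_zero]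

theorem OrthogonalSubspaces.span_left {s : Set (X → ℂ)}
    {B : Submodule ℂ (X → ℂ)} (h : ∀ a ∈ s, ∀ b ∈ B, a ⬝ᵥ star b = 0) :
    OrthogonalSubspaces (Submodule.span ℂ s) B := fun a ha b hb => by
  change a ⬝ᵥ star b = 0
  induction ha using Submodule.span_induction with
  | mem x hx => exact h x hx b hb
  | zero => exact zero_dotProduct _
  | add x y _ _ hx hy => rw [add_dotProduct, hx, hy, add_zero]
  | smul c x _ hx => rw [smul_dotProduct, hx, smul_zero]

theorem iSupIndep_of_orthogonalSubspaces {ι : Type*} {A : ι → Submodule ℂ (X → ℂ)}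
    (h : ∀ i j, i ≠ j → OrthogonalSubspaces (A i) (A j)) : iSupIndep A := fun i => by
  rw [Submodule.disjoint_def]
  intro x hx hx'
  have : OrthogonalSubspaces (⨆ j, ⨆ _ : j ≠ i, A j) (A i) :=
    OrthogonalSubspaces.iSup_left fun j => OrthogonalSubspaces.iSup_left fun hj => h j i hj
  exact eq_zero_of_dotProduct_star (this x hx' x hx)

theorem IsOrthogonalIsotypicDecomposition.hasMultiplicity {G W : Type*} [Group G] [Finite G]
    [AddCommGroup W] [Module ℂ W] {τ : Representation ℂ G (X → ℂ)} {ρ : Representation ℂ G W}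
    {m : ℕ} {A : Fin m → Subrepresentation τ} (hA : IsOrthogonalIsotypicDecomposition τ ρ A) :
    HasMultiplicity τ ρ m :=
  hasMultiplicity_of_isotypicPart A hA.1 hA.2.1
    (iSupIndep_of_orthogonalSubspaces hA.2.2.1) hA.2.2.2

variable {G : Type*} [Group G] [MulAction G X]

theorem permRep_dotProduct_star (g : G) (a b : X → ℂ) :
    permRep G X g a ⬝ᵥ star (permRep G X g b) = a ⬝ᵥ star b :=
  Equiv.sum_comp (MulAction.toPerm g⁻¹) fun x => a x * star (b x)

theorem permRep_dotProduct_star_left (g : G) (a b : X → ℂ) :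
    permRep G X g a ⬝ᵥ star b = a ⬝ᵥ star (permRep G X g⁻¹ b) := by
  rw [← permRep_dotProduct_star g a, permRep_self_inv_apply]

/-- The operator `f ↦ ∑ g, ⟨f, g u⟩ g v` on `L(X)`. -/
def averageRankOne [Fintype G] (u v : X → ℂ) : (X → ℂ) →ₗ[ℂ] X → ℂ where
  toFun f := ∑ g : G, (f ⬝ᵥ star (permRep G X g u)) • permRep G X g v
  map_add' a b := by simp only [add_dotProduct, add_smul, Finset.sum_add_distrib]
  map_smul' c a := by
    simp only [smul_dotProduct, smul_assoc, Finset.smul_sum, RingHom.id_apply]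

theorem averageRankOne_apply [Fintype G] (u v f : X → ℂ) : averageRankOne (G := G) u v f =
    ∑ g : G, (f ⬝ᵥ star (permRep G X g u)) • permRep G X g v := rfl

theorem averageRankOne_permRep [Fintype G] (u v f : X → ℂ) (g : G) :
    averageRankOne (G := G) u v (permRep G X g f) =
      permRep G X g (averageRankOne (G := G) u v f) := by
  rw [averageRankOne_apply, averageRankOne_apply, map_sum,
    ← Equiv.sum_comp (Equiv.mulLeft g)]
  refine Finset.sum_congr rfl fun k _ => ?_
  rw [map_smul, Equiv.coe_mulLeft, permRep_mul_apply, permRep_mul_apply,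
    permRep_dotProduct_star]

theorem averageRankOne_mem [Fintype G] (A : Subrepresentation (permRep G X)) (u : X → ℂ)
    {v : X → ℂ} (hv : v ∈ A.toSubmodule) (f : X → ℂ) :
    averageRankOne (G := G) u v f ∈ A.toSubmodule :=
  Submodule.sum_mem _ fun g _ => Submodule.smul_mem _ _ (A.apply_mem_toSubmodule g hv)

theorem averageRankOne_self_dotProduct [Fintype G] (u f : X → ℂ) :
    averageRankOne (G := G) u u f ⬝ᵥ star f =
      ((∑ g : G, ‖f ⬝ᵥ star (permRep G X g u)‖ ^ 2 : ℝ) : ℂ) := by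
  rw [averageRankOne_apply, sum_dotProduct, Complex.ofReal_sum]
  refine Finset.sum_congr rfl fun g _ => ?_
  rw [smul_dotProduct, smul_eq_mul, ← star_dotProduct_star_swap f, Complex.ofReal_pow]
  exact Complex.mul_conj' _

/-- The form is a sum of squares `|⟨f, g u⟩|²`, and the term `g = 1` is the one wanted. -/
theorem dotProduct_eq_zero_of_averageRankOne [Fintype G] {u f : X → ℂ}
    (h : averageRankOne (G := G) u u f ⬝ᵥ star f = 0) : f ⬝ᵥ star u = 0 := by
  rw [averageRankOne_self_dotProduct, Complex.ofReal_eq_zero,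
    Finset.sum_eq_zero_iff_of_nonneg fun _ _ => by positivity] at h
  have h1 := h 1 (Finset.mem_univ _)
  rw [map_one, Module.End.one_apply] at h1
  exact norm_eq_zero.1 (pow_eq_zero_iff two_ne_zero |>.1 h1)

/-- For `b ∈ B` the averaged operator `f ↦ ∑ g, ⟨f, g b⟩ g b` intertwines and lands in `B`, so
Schur's lemma makes it vanish on `A`; positivity then gives `⟨a, b⟩ = 0`. -/
theorem orthogonalSubspaces_of_not_equiv [Finite G] (A B : Subrepresentation (permRep G X))
    (hA : A.toRepresentation.IsIrreducible) (hB : B.toRepresentation.IsIrreducible)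
    (hAB : ¬ Nonempty (A.toRepresentation.Equiv B.toRepresentation)) :
    OrthogonalSubspaces A.toSubmodule B.toSubmodule := fun a ha b hb => by
  have := Fintype.ofFinite G
  refine dotProduct_eq_zero_of_averageRankOne (G := G) (f := a) (u := b) ?_
  rw [eq_zero_of_not_equiv A B hA hB hAB (averageRankOne (G := G) b b)
    (fun g x _ => averageRankOne_permRep b b x g) (fun x _ => averageRankOne_mem B b hb x) ha,
    zero_dotProduct]

/-- In a multiplicity free permutation representation every rank one operator
`f ↦ ⟨f, v⟩ u` with `u, v` in the same irreducible constituent comes from the group algebra. -/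
theorem exists_groupAlgebra_rankOne [Fintype G] {n : ℕ}
    (V : Fin n → Subrepresentation (permRep G X))
    (hV : IsIrreducibleDecomposition (permRep G X) V)
    (hVne : ∀ i j, i ≠ j →
      ¬ Nonempty ((V i).toRepresentation.Equiv (V j).toRepresentation))
    (k : Fin n) {u v : X → ℂ} (hu : u ∈ (V k).toSubmodule) (hv : v ∈ (V k).toSubmodule) :
    ∃ α : G → ℂ, ∀ f : X → ℂ, ∑ g, α g • permRep G X g f = (f ⬝ᵥ star v) • u := by
  by_cases hu0 : u = 0
  · exact ⟨0, fun f => by simp [hu0]⟩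
  have huu : u ⬝ᵥ star u ≠ 0 := fun h => hu0 (eq_zero_of_dotProduct_star h)
  obtain ⟨c, hc⟩ := exists_eq_smul_of_isIrreducible (V k) (hV.1 k)
    (averageRankOne (G := G) u u)
    (fun g x _ => averageRankOne_permRep u u x g) fun x _ => averageRankOne_mem (V k) u hu x
  have hc0 : c ≠ 0 := fun h => huu <| dotProduct_eq_zero_of_averageRankOne (G := G) <| by
    rw [hc u hu, h, zero_smul, zero_dotProduct]
  -- With these coefficients, `∑ g, α g • g f` is `⟨u, u⟩ / c` times `averageRankOne v f` applied to
  -- `u`: the roles of `f` and `u` are exchanged, so Schur's lemma can be used on `V k`.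
  refine ⟨fun g => (u ⬝ᵥ star u / c) • (u ⬝ᵥ star (permRep G X g v)), fun f => ?_⟩
  have hf : f ∈ ⨆ j, (V j).toSubmodule := hV.2.submodule_iSup_eq_top ▸ Submodule.mem_top
  simp only [smul_assoc, ← Finset.smul_sum]
  rw [← averageRankOne_apply]
  induction hf using Submodule.iSup_induction' with
  | mem j f hf =>
    by_cases hj : j = k
    · subst hj
      obtain ⟨d, hd⟩ := exists_eq_smul_of_isIrreducible (V j) (hV.1 j)
        (averageRankOne (G := G) v f) (fun g x _ => averageRankOne_permRep v f x g)
        fun x _ => averageRankOne_mem (V j) v hf x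
      -- Substituting `g⁻¹` for `g` identifies `⟨averageRankOne v f u, u⟩` with `⟨averageRankOne u u
      -- f, v⟩`.
      have h1 : d * (u ⬝ᵥ star u) = c * (f ⬝ᵥ star v) := by
        rw [← smul_eq_mul, ← smul_eq_mul, ← smul_dotProduct, ← smul_dotProduct, ← hd u hu,
          ← hc f hf, averageRankOne_apply, averageRankOne_apply, sum_dotProduct, sum_dotProduct,
          ← Equiv.sum_comp (Equiv.inv G)]
        refine Finset.sum_congr rfl fun g _ => ?_
        rw [smul_dotProduct, smul_dotProduct, smul_eq_mul, smul_eq_mul, Equiv.inv_apply,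
          permRep_dotProduct_star_left g⁻¹, permRep_dotProduct_star_left g, inv_inv, mul_comm]
      rw [hd u hu, smul_smul]
      congr 1
      field_simp
      linear_combination h1
    -- For `f` in another constituent both sides vanish; this is where inequivalence of the summands
    -- enters.
    · rw [eq_zero_of_not_equiv (V k) (V j) (hV.1 k) (hV.1 j) (hVne k j (Ne.symm hj))
        (averageRankOne (G := G) v f) (fun g x _ => averageRankOne_permRep v f x g)
        (fun x _ => averageRankOne_mem (V j) v hf x) hu,
        show f ⬝ᵥ star v = 0 from orthogonalSubspaces_of_not_equiv (V j) (V k) (hV.1 j) (hV.1 k)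
          (hVne j k hj) f hf v hv, zero_smul, smul_zero]
  | zero => simp [averageRankOne_apply]
  | add f f' _ _ hf hf' =>
    rw [add_dotProduct, add_smul, ← hf, ← hf', ← smul_add]
    simp only [averageRankOne_apply, map_add, smul_add, Finset.sum_add_distrib]

end Orthogonality

/-! ### Pure tensors on `Y^X × Z` and partial scalar products. -/

section PureFun

variable {X Y Z : Type*} [Fintype X]

/-- The function `(φ, z) ↦ (∏ x, v_x (φ x)) b(z)` on `Y^X × Z`. -/
def pureFun (v : X → Y → ℂ) (b : Z → ℂ) : (X → Y) × Z → ℂ :=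
  fun p => (∏ x, v x (p.1 x)) * b p.2

theorem pureFun_apply (v : X → Y → ℂ) (b : Z → ℂ) (p : (X → Y) × Z) :
    pureFun v b p = (∏ x, v x (p.1 x)) * b p.2 := rfl

/-- `pureFun` as a linear map in its second argument. -/
def pureFunHom (v : X → Y → ℂ) : (Z → ℂ) →ₗ[ℂ] ((X → Y) × Z → ℂ) where
  toFun := pureFun v
  map_add' b c := by ext p; simp [pureFun_apply, mul_add]
  map_smul' r b := by ext p; simp [pureFun_apply, mul_left_comm]

theorem pureFunHom_apply (v : X → Y → ℂ) (b : Z → ℂ) : pureFunHom v b = pureFun v b := rfl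

theorem pureFun_smul_left (c : X → ℂ) (v : X → Y → ℂ) (b : Z → ℂ) :
    pureFun (fun x => c x • v x) b = pureFun v ((∏ x, c x) • b) := by
  ext p
  simp only [pureFun_apply, Pi.smul_apply, smul_eq_mul, Finset.prod_mul_distrib]
  ring

theorem sum_pureFun [DecidableEq X] {ι : Type*} [Fintype ι] (a : X → ι → ℂ)
    (v : X → ι → Y → ℂ) (b : Z → ℂ) :
    ∑ f : X → ι, (∏ x, a x (f x)) • pureFun (fun x => v x (f x)) b =
      pureFun (fun x => ∑ i, a x i • v x i) b := by
  ext p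
  simp only [pureFun_apply, Finset.sum_apply, Pi.smul_apply, smul_eq_mul,
    Finset.prod_univ_sum, Fintype.piFinset_univ, Finset.sum_mul, Finset.prod_mul_distrib, mul_assoc]

theorem pureFun_dotProduct_star [DecidableEq X] [Fintype Y] [Fintype Z] (v u : X → Y → ℂ)
    (b c : Z → ℂ) :
    pureFun v b ⬝ᵥ star (pureFun u c) = (∏ x, v x ⬝ᵥ star (u x)) * (b ⬝ᵥ star c) := by
  simp only [dotProduct, Pi.star_apply, pureFun_apply, Fintype.sum_prod_type,
    Finset.prod_univ_sum, Fintype.piFinset_univ, Finset.sum_mul_sum, Finset.prod_mul_distrib,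
    star_mul', star_prod]
  exact Finset.sum_congr rfl fun _ _ => Finset.sum_congr rfl fun _ _ => by ring

/-- The partial scalar product `m ↦ (z ↦ ∑ φ, m(φ, z) conj (∏ x, v_x (φ x)))`. -/
def contract [DecidableEq X] [Fintype Y] (v : X → Y → ℂ) :
    ((X → Y) × Z → ℂ) →ₗ[ℂ] (Z → ℂ) where
  toFun m z := ∑ φ : X → Y, m (φ, z) * star (∏ x, v x (φ x))
  map_add' a b := by ext z; simp [add_mul, Finset.sum_add_distrib]
  map_smul' c a := by ext z; simp [mul_assoc, Finset.mul_sum]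

theorem contract_apply [DecidableEq X] [Fintype Y] (v : X → Y → ℂ) (m : (X → Y) × Z → ℂ) (z : Z) :
    contract v m z = ∑ φ : X → Y, m (φ, z) * star (∏ x, v x (φ x)) := rfl

theorem contract_pureFun [DecidableEq X] [Fintype Y] (v u : X → Y → ℂ) (b : Z → ℂ) :
    contract v (pureFun u b) = (∏ x, u x ⬝ᵥ star (v x)) • b := by
  ext z
  simp only [contract_apply, dotProduct, Pi.star_apply, Pi.smul_apply, pureFun_apply,
    Finset.prod_univ_sum, Fintype.piFinset_univ, Finset.sum_mul, Finset.prod_mul_distrib,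
    star_prod, smul_eq_mul]
  exact Finset.sum_congr rfl fun _ _ => by ring

theorem single_eq_pureFun [DecidableEq X] [DecidableEq Y] [DecidableEq Z] (p : (X → Y) × Z)
    (c : ℂ) : Pi.single p c = pureFun (fun x => Pi.single (p.1 x) 1) (Pi.single p.2 c) := by
  ext q
  by_cases h1 : q.1 = p.1
  · by_cases h2 : q.2 = p.2
    · rw [show q = p from Prod.ext h1 h2]
      simp [pureFun_apply]
    · rw [Pi.single_eq_of_ne (fun h => h2 (congrArg Prod.snd h)), pureFun_apply,
        Pi.single_eq_of_ne h2, mul_zero]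
  · obtain ⟨x, hx⟩ := Function.ne_iff.1 h1
    rw [Pi.single_eq_of_ne (fun h => h1 (congrArg Prod.fst h)), pureFun_apply,
      Finset.prod_eq_zero (Finset.mem_univ x) (Pi.single_eq_of_ne hx 1), zero_mul]

theorem linearMap_ext_pureFun [DecidableEq X] [Finite Y] [Finite Z] {M : Type*} [AddCommMonoid M]
    [Module ℂ M] {f g : ((X → Y) × Z → ℂ) →ₗ[ℂ] M}
    (h : ∀ v b, f (pureFun v b) = g (pureFun v b)) : f = g := by
  classical
  refine LinearMap.pi_ext fun p c => ?_
  rw [single_eq_pureFun]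
  exact h _ _

/-- A function orthogonal to all products of elements of the subspaces `V k` vanishes if
the subspaces `V k` span. -/
theorem eq_zero_of_contract [DecidableEq X] [Fintype Y] {n : ℕ} (V : Fin n → Submodule ℂ (Y → ℂ))
    (hV : ⨆ k, V k = ⊤) (m : (X → Y) × Z → ℂ)
    (hm : ∀ (h : X → Fin n) (v : X → Y → ℂ), (∀ x, v x ∈ V (h x)) → contract v m = 0) : m = 0 := by
  classical
  -- Contraction with a product of delta functions is evaluation at a point of `Y^X`; splitting each
  -- delta along the `V k` writes it as a sum of contractions of definite type.
  have hδ : ∀ y : Y, ∃ u : Fin n → Y → ℂ, (∀ k, u k ∈ V k) ∧ ∑ k, u k = Pi.single y 1 := by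
    intro y
    have h1 : (Pi.single y 1 : Y → ℂ) ∈ ⨆ k, V k := hV ▸ Submodule.mem_top
    obtain ⟨u, hu⟩ := (Submodule.mem_iSup_iff_exists_finsupp _ _).1 h1
    refine ⟨u, hu.1, ?_⟩
    rw [← hu.2, Finsupp.sum_fintype _ _ fun _ => rfl]
  choose u hu hsum using hδ
  ext ⟨φ, z⟩
  have h1 : contract (fun x => ∑ k, (1 : ℂ) • u (φ x) k) m z = 0 := by
    have h2 : ∀ ψ : X → Y, ∏ x, (∑ k, (1 : ℂ) • u (φ x) k) (ψ x) =
        ∑ h : X → Fin n, ∏ x, u (φ x) (h x) (ψ x) := fun ψ => by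
      simp only [one_smul, Finset.sum_apply, Finset.prod_univ_sum, Fintype.piFinset_univ]
    simp only [contract_apply, h2, star_sum, Finset.mul_sum]
    rw [Finset.sum_comm]
    exact Finset.sum_eq_zero fun h _ => congrFun (hm h _ fun x => hu (φ x) (h x)) z
  simp only [one_smul, hsum, contract_apply] at h1
  rw [Finset.sum_eq_single φ (fun ψ _ hψ => ?_) (by simp)] at h1
  · simpa using h1
  · obtain ⟨x, hx⟩ := Function.ne_iff.1 hψ
    rw [Finset.prod_eq_zero (Finset.mem_univ x) (Pi.single_eq_of_ne hx 1), star_zero, mul_zero]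

end PureFun

/-! ### The wreath product acting on pure tensors. -/

section Wreath

variable {F G X Y Z : Type*} [Group F] [Group G] [Fintype X] [MulAction G X] [MulAction F Y]
  [MulAction G Z]

theorem permRep_pureFun (w : WreathProduct F G X) (v : X → Y → ℂ) (b : Z → ℂ) :
    permRep (WreathProduct F G X) ((X → Y) × Z) w (pureFun v b) =
      pureFun (fun x => permRep F Y (w.left x) (v (w.right⁻¹ • x))) (permRep G Z w.right b) := by
  ext ⟨φ, z⟩
  change (∏ x, v x ((w⁻¹).left x • φ ((w⁻¹).right⁻¹ • x))) * b ((w⁻¹).right • z) =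
    (∏ x, v (w.right⁻¹ • x) ((w.left x)⁻¹ • φ x)) * b (w.right⁻¹ • z)
  rw [SemidirectProduct.inv_right, SemidirectProduct.inv_left, inv_inv,
    ← Equiv.prod_comp (MulAction.toPerm w.right)
      fun x => v (w.right⁻¹ • x) ((w.left x)⁻¹ • φ x)]
  congr 1
  refine Finset.prod_congr rfl fun x _ => ?_
  rw [MulAction.toPerm_apply, inv_smul_smul]
  change v x ((w.left ((w.right⁻¹)⁻¹ • x))⁻¹ • _) = _
  rw [inv_inv]

theorem permRep_inl_pureFun (f : X → F) (v : X → Y → ℂ) (b : Z → ℂ) :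
    permRep (WreathProduct F G X) ((X → Y) × Z) (SemidirectProduct.inl f) (pureFun v b) =
      pureFun (fun x => permRep F Y (f x) (v x)) b := by
  rw [permRep_pureFun]
  simp

theorem permRep_inr_pureFun (g : G) (v : X → Y → ℂ) (b : Z → ℂ) :
    permRep (WreathProduct F G X) ((X → Y) × Z) (SemidirectProduct.inr g) (pureFun v b) =
      pureFun (fun x => v (g⁻¹ • x)) (permRep G Z g b) := by
  rw [permRep_pureFun]
  simp

/-- On pure tensors the sum over `F^X` factors over `X` into the given rank-one operators, while the
`Z` factor is untouched; pure tensors span. -/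
theorem sum_groupAlgebra_permRep [DecidableEq X] [Fintype F] [Fintype Y] [Finite Z]
    {u v : X → Y → ℂ} {α : X → F → ℂ}
    (hα : ∀ x (f : Y → ℂ), ∑ g, α x g • permRep F Y g f = (f ⬝ᵥ star (v x)) • u x)
    (m : (X → Y) × Z → ℂ) :
    ∑ f : X → F, (∏ x, α x (f x)) •
      permRep (WreathProduct F G X) ((X → Y) × Z) (SemidirectProduct.inl f) m =
      pureFun u (contract v m) := by
  have key : ∑ f : X → F, (∏ x, α x (f x)) •
      permRep (WreathProduct F G X) ((X → Y) × Z) (SemidirectProduct.inl f) =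
      pureFunHom u ∘ₗ contract v := by
    refine linearMap_ext_pureFun fun w b => ?_
    simp only [LinearMap.sum_apply, LinearMap.smul_apply, permRep_inl_pureFun,
      LinearMap.comp_apply, contract_pureFun, pureFunHom_apply]
    rw [sum_pureFun α fun x g => permRep F Y g (w x), ← pureFun_smul_left]
    simp only [hα]
  have := LinearMap.congr_fun key m
  rwa [LinearMap.sum_apply] at this

end Wreath

/-! ### The summands `V_{sh} ⊗ sB` and their sum. -/

section Summand

variable {F G X Y Z κ : Type*} [Group F] [Group G] [Fintype X] [MulAction G X] [MulAction F Y]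
  [MulAction G Z]

theorem translatedSummand_eq_span (V : κ → Submodule ℂ (Y → ℂ)) (h : X → κ)
    (B : Submodule ℂ (Z → ℂ)) (s : G) : translatedSummand V h B s =
      Submodule.span ℂ {ψ | ∃ v : X → Y → ℂ, (∀ x, v x ∈ V (h (s⁻¹ • x))) ∧
        ∃ b ∈ B, ψ = pureFun v (permRep G Z s b)} := by
  refine le_antisymm (Submodule.span_le.2 ?_) (Submodule.span_mono ?_)
  · rintro _ ⟨a, ha, _, ⟨b, hb, rfl⟩, rfl⟩
    rw [SetLike.mem_coe]
    induction ha using Submodule.span_induction with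
    | mem a ha =>
      obtain ⟨v, hv, rfl⟩ := ha
      exact Submodule.subset_span ⟨v, hv, b, hb, rfl⟩
    | zero =>
      rw [show (fun p : (X → Y) × Z => (0 : (X → Y) → ℂ) p.1 * permRep G Z s b p.2) = 0 by
        ext; simp]
      exact zero_mem _
    | add a a' _ _ ha ha' =>
      rw [show (fun p : (X → Y) × Z => (a + a') p.1 * permRep G Z s b p.2) =
        (fun p => a p.1 * permRep G Z s b p.2) + fun p => a' p.1 * permRep G Z s b p.2 by
        ext; simp [add_mul]]
      exact add_mem ha ha'
    | smul c a _ ha =>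
      rw [show (fun p : (X → Y) × Z => (c • a) p.1 * permRep G Z s b p.2) =
        c • fun p => a p.1 * permRep G Z s b p.2 by ext; simp [mul_assoc]]
      exact Submodule.smul_mem _ c ha
  · rintro _ ⟨v, hv, b, hb, rfl⟩
    exact ⟨_, Submodule.subset_span ⟨v, hv, rfl⟩, _, ⟨b, hb, rfl⟩, rfl⟩

theorem translatedSummand_le_iff {V : κ → Submodule ℂ (Y → ℂ)} {h : X → κ}
    {B : Submodule ℂ (Z → ℂ)} {s : G} {N : Submodule ℂ ((X → Y) × Z → ℂ)} :
    translatedSummand V h B s ≤ N ↔ ∀ v : X → Y → ℂ, (∀ x, v x ∈ V (h (s⁻¹ • x))) →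
      ∀ b ∈ B, pureFun v (permRep G Z s b) ∈ N := by
  rw [translatedSummand_eq_span, Submodule.span_le]
  constructor
  · exact fun H v hv b hb => H ⟨v, hv, b, hb, rfl⟩
  · rintro H _ ⟨v, hv, b, hb, rfl⟩
    exact H v hv b hb

theorem pureFun_mem_translatedSummand {V : κ → Submodule ℂ (Y → ℂ)} {h : X → κ}
    {B : Submodule ℂ (Z → ℂ)} {s : G} {v : X → Y → ℂ} (hv : ∀ x, v x ∈ V (h (s⁻¹ • x)))
    {b : Z → ℂ} (hb : b ∈ B) :
    pureFun v (permRep G Z s b) ∈ translatedSummand V h B s :=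
  translatedSummand_le_iff.1 le_rfl v hv b hb

variable (V : κ → Subrepresentation (permRep F Y)) (h : X → κ)

theorem permRep_mem_translatedSummand (B : Submodule ℂ (Z → ℂ)) (w : WreathProduct F G X) (s : G)
    {m : (X → Y) × Z → ℂ}
    (hm : m ∈ translatedSummand (fun k => (V k).toSubmodule) h B s) :
    permRep (WreathProduct F G X) ((X → Y) × Z) w m ∈
      translatedSummand (fun k => (V k).toSubmodule) h B (w.right * s) := by
  refine translatedSummand_le_iff (N := Submodule.comap
    (permRep (WreathProduct F G X) ((X → Y) × Z) w) (translatedSummand _ h B (w.right * s))).2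
    (fun v hv b hb => ?_) hm
  rw [Submodule.mem_comap, permRep_pureFun, ← permRep_mul_apply]
  refine pureFun_mem_translatedSummand (fun x => ?_) hb
  refine (V _).apply_mem_toSubmodule _ ?_
  rw [mul_inv_rev, mul_smul]
  exact hv _

variable (B : Subrepresentation ((permRep G Z).comp (typeStabilizer G h).subtype))

/-- An element of `I` fixes `h` and preserves `B`, so the summand depends only on the coset `sI`. -/
theorem translatedSummand_mul_le (s : G) {g : G} (hg : g ∈ typeStabilizer G h) :
    translatedSummand (fun k => (V k).toSubmodule) h B.toSubmodule (s * g) ≤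
      translatedSummand (fun k => (V k).toSubmodule) h B.toSubmodule s := by
  refine translatedSummand_le_iff.2 fun v hv b hb => ?_
  rw [permRep_mul_apply]
  refine pureFun_mem_translatedSummand (fun x => ?_) (B.apply_mem_toSubmodule ⟨g, hg⟩ hb)
  have := hv x
  rwa [mul_inv_rev, mul_smul, typeStabilizer_inv_smul hg] at this

/-- Allows summation over all of `G`, an index set that the wreath product visibly permutes, in
place of the representatives `S`. -/
theorem iSup_translatedSummand_eq {S : Set G}
    (hS : Subgroup.IsComplement S (typeStabilizer G h : Set G)) :
    ⨆ s ∈ S, translatedSummand (fun k => (V k).toSubmodule) h B.toSubmodule s =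
      ⨆ s : G, translatedSummand (fun k => (V k).toSubmodule) h B.toSubmodule s := by
  refine le_antisymm (iSup₂_le fun s _ => le_iSup _ s) (iSup_le fun g => ?_)
  obtain ⟨⟨⟨s, hs⟩, ⟨i, hi⟩⟩, hsi⟩ := hS.2 g
  dsimp only at hsi
  rw [← hsi]
  exact (translatedSummand_mul_le V h B s hi).trans (le_iSup₂_of_le s hs le_rfl)

/-- The subrepresentation `⨁_s V_{sh} ⊗ sB` of `L(Y^X × Z)`. -/
def wreathSubrep : Subrepresentation (permRep (WreathProduct F G X) ((X → Y) × Z)) where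
  toSubmodule := ⨆ s : G, translatedSummand (fun k => (V k).toSubmodule) h B.toSubmodule s
  apply_mem_toSubmodule w m hm := by
    suffices hle : (⨆ s : G, translatedSummand (fun k => (V k).toSubmodule) h B.toSubmodule s) ≤
        (⨆ s : G, translatedSummand (fun k => (V k).toSubmodule) h B.toSubmodule s).comap
          (permRep (WreathProduct F G X) ((X → Y) × Z) w) from hle hm
    exact iSup_le fun s m hm =>
      Submodule.mem_iSup_of_mem (w.right * s) (permRep_mem_translatedSummand V h _ w s hm)

end Summand

/-! ### Cosets of the stabilizer correspond to translates of `h`. -/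

section TypeStabilizer

variable {G X κ : Type*} [Group G] [MulAction G X]

theorem inv_mul_mem_typeStabilizer {h : X → κ} {s t : G}
    (hst : ∀ x, h (s⁻¹ • x) = h (t⁻¹ • x)) : s⁻¹ * t ∈ typeStabilizer G h := fun x => by
  rw [mul_smul, hst, inv_smul_smul]

theorem exists_ne_of_isComplement {h : X → κ} {S : Set G}
    (hS : Subgroup.IsComplement S (typeStabilizer G h : Set G)) {s t : G} (hs : s ∈ S) (ht : t ∈ S)
    (hst : s ≠ t) : ∃ x, h (s⁻¹ • x) ≠ h (t⁻¹ • x) := by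
  by_contra! H
  have := @hS.1 ⟨⟨s, hs⟩, ⟨s⁻¹ * t, inv_mul_mem_typeStabilizer H⟩⟩
    ⟨⟨t, ht⟩, ⟨1, (typeStabilizer G h).one_mem⟩⟩ (by simp)
  exact hst (congrArg (fun p => (p.1 : G)) this)

end TypeStabilizer

/-! ### Orthogonality of the summands and of the `W_i`. -/

section Orthogonal

variable {F G X Y Z κ : Type*} [Group F] [Group G] [Fintype X] [DecidableEq X] [MulAction G X]
  [MulAction F Y] [MulAction G Z] [Fintype Y] [Fintype Z]

theorem orthogonalSubspaces_translatedSummand {V : κ → Submodule ℂ (Y → ℂ)} {h : X → κ}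
    {B C : Submodule ℂ (Z → ℂ)} {s t : G}
    (H : ∀ v u : X → Y → ℂ, (∀ x, v x ∈ V (h (s⁻¹ • x))) → (∀ x, u x ∈ V (h (t⁻¹ • x))) →
      ∀ b ∈ B, ∀ c ∈ C,
        (∏ x, v x ⬝ᵥ star (u x)) * (permRep G Z s b ⬝ᵥ star (permRep G Z t c)) = 0) :
    OrthogonalSubspaces (translatedSummand V h B s) (translatedSummand V h C t) := by
  rw [translatedSummand_eq_span (s := s)]
  refine OrthogonalSubspaces.span_left ?_
  rintro _ ⟨v, hv, b, hb, rfl⟩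
  suffices OrthogonalSubspaces (translatedSummand V h C t)
      (Submodule.span ℂ {pureFun v (permRep G Z s b)}) from fun a ha =>
    this.symm _ (Submodule.mem_span_singleton_self _) a ha
  rw [translatedSummand_eq_span]
  refine OrthogonalSubspaces.span_left ?_
  rintro _ ⟨u, hu, c, hc, rfl⟩ a ha
  obtain ⟨r, rfl⟩ := Submodule.mem_span_singleton.1 ha
  rw [star_smul, dotProduct_smul, ← star_dotProduct_star_swap, pureFun_dotProduct_star,
    H v u hv hu b hb c hc, star_zero, smul_zero]

theorem orthogonalSubspaces_translatedSummand_of_ne {V : κ → Submodule ℂ (Y → ℂ)}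
    (hV : ∀ i j, i ≠ j → OrthogonalSubspaces (V i) (V j)) {h : X → κ}
    (B C : Submodule ℂ (Z → ℂ)) {s t : G} {x : X} (hx : h (s⁻¹ • x) ≠ h (t⁻¹ • x)) :
    OrthogonalSubspaces (translatedSummand V h B s) (translatedSummand V h C t) :=
  orthogonalSubspaces_translatedSummand fun v u hv hu b _ c _ => by
    rw [Finset.prod_eq_zero (Finset.mem_univ x) (hV _ _ hx _ (hv x) _ (hu x) :), zero_mul]

variable (V : κ → Subrepresentation (permRep F Y)) (h : X → κ)

/-- If `sh ≠ th`, some factor over `X` of the scalar product is zero. If `sh = th`, both summands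
can be written with the same `s`, and unitarity of translation reduces the claim to `B ⊥ C`. -/
theorem orthogonalSubspaces_wreathSubrep
    (hV : ∀ i j, i ≠ j → OrthogonalSubspaces (V i).toSubmodule (V j).toSubmodule)
    (B C : Subrepresentation ((permRep G Z).comp (typeStabilizer G h).subtype))
    (hBC : OrthogonalSubspaces B.toSubmodule C.toSubmodule) :
    OrthogonalSubspaces (wreathSubrep V h B).toSubmodule (wreathSubrep V h C).toSubmodule := by
  refine OrthogonalSubspaces.iSup_left fun s => OrthogonalSubspaces.symm ?_
  refine OrthogonalSubspaces.iSup_left fun t => OrthogonalSubspaces.symm ?_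
  by_cases hst : ∀ x, h (s⁻¹ • x) = h (t⁻¹ • x)
  · have hle := translatedSummand_mul_le V h C s (inv_mul_mem_typeStabilizer hst)
    rw [mul_inv_cancel_left] at hle
    refine fun a ha b hb => orthogonalSubspaces_translatedSummand (fun v u _ _ b hb c hc => ?_)
      a ha b (hle hb)
    rw [permRep_dotProduct_star, show b ⬝ᵥ star c = 0 from hBC b hb c hc, mul_zero]
  · push Not at hst
    obtain ⟨x, hx⟩ := hst
    exact orthogonalSubspaces_translatedSummand_of_ne hV _ _ hx

end Orthogonal

/-! ### Irreducibility of `W_i`. -/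

section Irreducible

variable {F G X Y Z : Type*} [Group F] [Group G] [Fintype X] [DecidableEq X] [MulAction G X]
  [MulAction F Y] [MulAction G Z] [Fintype Y]
  {n : ℕ} (V : Fin n → Subrepresentation (permRep F Y))
  (h : X → Fin n)

theorem exists_mem_ne_zero_of_isIrreducible {G V : Type*} [Group G] [AddCommGroup V] [Module ℂ V]
    {τ : Representation ℂ G V} (A : Subrepresentation τ)
    (hA : A.toRepresentation.IsIrreducible) : ∃ x ∈ A.toSubmodule, x ≠ 0 :=
  Submodule.exists_mem_ne_zero_of_ne_bot (ne_bot_of_isIrreducible A hA)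

theorem pureFun_contract_mem [Finite F] [Finite Z]
    (hV : IsIrreducibleDecomposition (permRep F Y) V)
    (hVne : ∀ i j, i ≠ j →
      ¬ Nonempty ((V i).toRepresentation.Equiv (V j).toRepresentation))
    {M : Submodule ℂ ((X → Y) × Z → ℂ)}
    (hM : ∀ (w : WreathProduct F G X), ∀ m ∈ M, permRep _ ((X → Y) × Z) w m ∈ M)
    {u v : X → Y → ℂ} (hu : ∀ x, u x ∈ (V (h x)).toSubmodule)
    (hv : ∀ x, v x ∈ (V (h x)).toSubmodule) {m : (X → Y) × Z → ℂ} (hm : m ∈ M) :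
    pureFun u (contract v m) ∈ M := by
  have := Fintype.ofFinite F
  choose α hα using fun x => exists_groupAlgebra_rankOne V hV hVne (h x) (hu x) (hv x)
  rw [← sum_groupAlgebra_permRep (G := G) hα m]
  exact Submodule.sum_mem _ fun f _ => Submodule.smul_mem _ _ (hM _ m hm)

/-- Contraction against a vector of type `h'` kills every summand with `sh ≠ h'`, and the summands
with `sh = h'` all have the same second factor `sB`. -/
theorem contract_mem_map (hO : ∀ i j, i ≠ j →
      OrthogonalSubspaces (V i).toSubmodule (V j).toSubmodule)
    (B : Subrepresentation ((permRep G Z).comp (typeStabilizer G h).subtype))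
    {m : (X → Y) × Z → ℂ} (hm : m ∈ (wreathSubrep V h B).toSubmodule)
    {h' : X → Fin n} {v : X → Y → ℂ} (hv : ∀ x, v x ∈ (V (h' x)).toSubmodule)
    (hne : contract v m ≠ 0) :
    ∃ s : G, (∀ x, h' x = h (s⁻¹ • x)) ∧ ∃ b ∈ B.toSubmodule, permRep G Z s b = contract v m := by
  -- Used with `N = sB` when `h'` is a translate of `h`, and with `N = ⊥` otherwise, where it
  -- contradicts `hne`.
  have key : ∀ N : Submodule ℂ (Z → ℂ), (∀ s : G, (∀ x, h' x = h (s⁻¹ • x)) →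
      B.toSubmodule.map (permRep G Z s) ≤ N) → contract v m ∈ N := by
    intro N hN
    suffices hle : (wreathSubrep V h B).toSubmodule ≤ N.comap (contract v) from hle hm
    refine iSup_le fun t => translatedSummand_le_iff.2 fun u hu b hb => ?_
    rw [Submodule.mem_comap, contract_pureFun]
    by_cases ht : ∀ x, h' x = h (t⁻¹ • x)
    · exact N.smul_mem _ (hN t ht ⟨b, hb, rfl⟩)
    · push Not at ht
      obtain ⟨x, hx⟩ := ht
      rw [Finset.prod_eq_zero (Finset.mem_univ x) (hO _ _ hx.symm _ (hu x) _ (hv x) :), zero_smul]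
      exact zero_mem _
  by_cases hs : ∃ s : G, ∀ x, h' x = h (s⁻¹ • x)
  · obtain ⟨s, hs⟩ := hs
    refine ⟨s, hs, key (B.toSubmodule.map (permRep G Z s)) fun t ht => ?_⟩
    rintro _ ⟨b, hb, rfl⟩
    refine ⟨_, B.apply_mem_toSubmodule ⟨s⁻¹ * t, inv_mul_mem_typeStabilizer fun x => ?_⟩ hb, ?_⟩
    · rw [← hs, ht]
    · change permRep G Z s (permRep G Z (s⁻¹ * t) b) = permRep G Z t b
      rw [← permRep_mul_apply, mul_inv_cancel_left]
  · exact absurd ((Submodule.mem_bot ℂ).1 (key ⊥ fun s hs' => absurd ⟨s, hs'⟩ hs)) hne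

theorem isIrreducible_wreathSubrep [Finite F] [Finite Z]
    (hV : IsIrreducibleDecomposition (permRep F Y) V)
    (hVne : ∀ i j, i ≠ j →
      ¬ Nonempty ((V i).toRepresentation.Equiv (V j).toRepresentation))
    (B : Subrepresentation ((permRep G Z).comp (typeStabilizer G h).subtype))
    (hB : B.toRepresentation.IsIrreducible) :
    (wreathSubrep V h B).toRepresentation.IsIrreducible := by
  have hO : ∀ i j, i ≠ j → OrthogonalSubspaces (V i).toSubmodule (V j).toSubmodule :=
    fun i j hij => orthogonalSubspaces_of_not_equiv _ _ (hV.1 i) (hV.1 j) (hVne i j hij)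
  refine isIrreducible_of_forall_submodule _ (fun hbot => ?_) fun M hMW hM hM0 => ?_
  · obtain ⟨b, hb, hb0⟩ := exists_mem_ne_zero_of_isIrreducible B hB
    choose e he he0 using fun k => exists_mem_ne_zero_of_isIrreducible (V k) (hV.1 k)
    have h1 : pureFun (fun x => e (h x)) (permRep G Z 1 b) ∈ (wreathSubrep V h B).toSubmodule :=
      Submodule.mem_iSup_of_mem 1 (pureFun_mem_translatedSummand (fun x => by
        rw [inv_one, one_smul]; exact he _) hb)
    rw [hbot, Submodule.mem_bot, map_one, Module.End.one_apply] at h1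
    have h2 := contract_pureFun (fun x => e (h x)) (fun x => e (h x)) b
    rw [h1, map_zero, eq_comm, smul_eq_zero, Finset.prod_eq_zero_iff] at h2
    rcases h2 with ⟨x, -, hx⟩ | h2
    · exact he0 _ (eq_zero_of_dotProduct_star hx)
    · exact hb0 h2
  · obtain ⟨m, hm, hm0⟩ := Submodule.exists_mem_ne_zero_of_ne_bot hM0
    obtain ⟨h', v, hv, hne⟩ : ∃ (h' : X → Fin n) (v : X → Y → ℂ),
        (∀ x, v x ∈ (V (h' x)).toSubmodule) ∧ contract v m ≠ 0 := by
      by_contra! H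
      exact hm0 (eq_zero_of_contract _ hV.2.submodule_iSup_eq_top m H)
    obtain ⟨s, hs, b, hb, hbm⟩ := contract_mem_map V h hO B (hMW hm) hv hne
    -- The functions on `Z` whose tensor product with every pure tensor of type `h` lies in `M`.
    let N : Submodule ℂ (Z → ℂ) :=
      ⨅ (u : X → Y → ℂ) (_ : ∀ x, u x ∈ (V (h x)).toSubmodule), M.comap (pureFunHom u)
    have hN : ∀ c, c ∈ N ↔
        ∀ u : X → Y → ℂ, (∀ x, u x ∈ (V (h x)).toSubmodule) → pureFun u c ∈ M := by
      intro c
      simp only [N, Submodule.mem_iInf, Submodule.mem_comap, pureFunHom_apply]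
    have hbN : b ∈ N := by
      refine (hN b).2 fun u hu => ?_
      -- The contraction has type `h' = sh`; here `u` is moved to that type, and translating back by
      -- `s⁻¹` returns to type `h`.
      have h1 : pureFun (fun x => u (s⁻¹ • x)) (permRep G Z s b) ∈ M := by
        rw [hbm]
        refine pureFun_contract_mem V h' hV hVne hM (fun x => ?_) hv hm
        rw [hs]
        exact hu _
      have h2 := hM (SemidirectProduct.inr s⁻¹) _ h1
      rw [permRep_inr_pureFun, permRep_inv_apply_self] at h2
      simpa only [inv_inv, inv_smul_smul] using h2
    have hb0 : b ≠ 0 := by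
      rintro rfl
      exact hne (by rw [← hbm, map_zero])
    have hBN : B.toSubmodule ≤ N := by
      refine le_of_isIrreducible B hB (fun g c hc _ => (hN _).2 fun u hu => ?_) hbN hb hb0
      have h1 := hM (SemidirectProduct.inr (g : G)) _
        ((hN c).1 hc (fun x => u ((g : G) • x)) fun x => g.2 x ▸ hu _)
      rw [permRep_inr_pureFun] at h1
      simp only [smul_inv_smul] at h1
      exact h1
    refine iSup_le fun t => translatedSummand_le_iff.2 fun u hu c hc => ?_
    have h1 := hM (SemidirectProduct.inr t) _ ((hN c).1 (hBN hc) (fun x => u (t • x)) fun x => by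
      simpa only [inv_smul_smul] using hu (t • x))
    rw [permRep_inr_pureFun] at h1
    simpa only [smul_inv_smul] using h1

end Irreducible

/-! ### Frobenius reciprocity for the induced representation. -/

section Induced

variable {G H A M : Type*} [Group G] [Group H] [AddCommGroup A] [Module ℂ A]
  [AddCommGroup M] [Module ℂ M] (φ : H →* G) (ρ : Representation ℂ H A)
  (τ : Representation ℂ G M)

theorem indV_mk_mul (g : G) (k : H) (a : A) :
    Representation.IndV.mk φ ρ (φ k * g) (ρ k a) = Representation.IndV.mk φ ρ g a := by
  have := Representation.Coinvariants.mk_self_apply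
    (Representation.tprod ((Representation.leftRegular ℂ G).comp φ) ρ) k
    (MonoidAlgebra.single g 1 ⊗ₜ a)
  simpa using this

/-- The map `[g, a] ↦ τ(g⁻¹) f(a)` on the induced representation (Frobenius reciprocity). -/
def indLift (f : A →ₗ[ℂ] M) (hf : ∀ k a, f (ρ k a) = τ (φ k) (f a)) :
    Representation.IndV φ ρ →ₗ[ℂ] M :=
  Representation.Coinvariants.lift _
    (TensorProduct.lift <| (Finsupp.lift _ _ _ fun g => τ g⁻¹ ∘ₗ f) ∘ₗ
      (MonoidAlgebra.coeffLinearEquiv ℂ).toLinearMap)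
    fun k => by
      ext g a
      simp only [LinearMap.coe_comp, Function.comp_apply, MonoidAlgebra.lsingle_apply]
      simp [Representation.ofMulAction_single, mul_inv_rev, hf]

theorem indLift_mk (f : A →ₗ[ℂ] M) (hf : ∀ k a, f (ρ k a) = τ (φ k) (f a)) (g : G) (a : A) :
    indLift φ ρ τ f hf (Representation.IndV.mk φ ρ g a) = τ g⁻¹ (f a) := by
  simp [indLift]

theorem indLift_ind (f : A →ₗ[ℂ] M) (hf : ∀ k a, f (ρ k a) = τ (φ k) (f a)) (g : G)
    (x : Representation.IndV φ ρ) :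
    indLift φ ρ τ f hf (Representation.ind φ ρ g x) = τ g (indLift φ ρ τ f hf x) := by
  suffices indLift φ ρ τ f hf ∘ₗ Representation.ind φ ρ g = τ g ∘ₗ indLift φ ρ τ f hf from
    LinearMap.congr_fun this x
  refine Representation.IndV.hom_ext φ ρ fun g' => LinearMap.ext fun a => ?_
  change indLift φ ρ τ f hf (Representation.ind φ ρ g (Representation.IndV.mk φ ρ g' a)) =
    τ g (indLift φ ρ τ f hf (Representation.IndV.mk φ ρ g' a))
  rw [Representation.ind_mk, indLift_mk, indLift_mk, mul_inv_rev, inv_inv, map_mul,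
    Module.End.mul_apply]

/-- `R` recovers `a` from `f a` and kills translates from other cosets, so `m ↦ ∑ s, [(t s)⁻¹, R (τ
(t s)⁻¹ m)]` is a left inverse. The inverses come from the convention that `[g, a]` maps to `τ g⁻¹
(f a)`. No equivariance of `R` is needed. -/
theorem indLift_injective (f : A →ₗ[ℂ] M) (hf : ∀ k a, f (ρ k a) = τ (φ k) (f a))
    {ι : Type*} [Fintype ι] (t : ι → G) (ht : ∀ g, ∃ s k, g = t s * φ k) (R : M →ₗ[ℂ] A)
    (hR : ∀ s a, R (τ (t s)⁻¹ (τ (t s) (f a))) = a)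
    (hR' : ∀ s s', s ≠ s' → ∀ a, R (τ (t s)⁻¹ (τ (t s') (f a))) = 0) :
    Function.Injective (indLift φ ρ τ f hf) := by
  let Ψ : M →ₗ[ℂ] Representation.IndV φ ρ :=
    ∑ s, Representation.IndV.mk φ ρ (t s)⁻¹ ∘ₗ R ∘ₗ τ (t s)⁻¹
  have hΨ : ∀ m, Ψ m = ∑ s, Representation.IndV.mk φ ρ (t s)⁻¹ (R (τ (t s)⁻¹ m)) := fun m => by
    simp only [Ψ, LinearMap.sum_apply]
    rfl
  have key : Ψ ∘ₗ indLift φ ρ τ f hf = LinearMap.id := by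
    refine Representation.IndV.hom_ext φ ρ fun g => LinearMap.ext fun a => ?_
    change Ψ (indLift φ ρ τ f hf (Representation.IndV.mk φ ρ g a)) =
      Representation.IndV.mk φ ρ g a
    obtain ⟨s, k, hsk⟩ := ht g⁻¹
    rw [← indV_mk_mul φ ρ g k a, show φ k * g = (t s)⁻¹ by
      rw [← inv_inv g, hsk, mul_inv_rev, mul_inv_cancel_left], indLift_mk, hΨ, inv_inv,
      Finset.sum_eq_single s (fun s' _ hs' => by rw [hR' s' s hs', map_zero]) (by simp), hR]
  exact Function.LeftInverse.injective (g := Ψ) fun x => LinearMap.congr_fun key x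

theorem range_indLift (f : A →ₗ[ℂ] M) (hf : ∀ k a, f (ρ k a) = τ (φ k) (f a))
    (N : Submodule ℂ M) (hN : ∀ g a, τ g (f a) ∈ N)
    (hN' : N ≤ Submodule.span ℂ {m | ∃ g a, m = τ g (f a)}) :
    LinearMap.range (indLift φ ρ τ f hf) = N := by
  refine le_antisymm ?_ (hN'.trans (Submodule.span_le.2 ?_))
  · rintro _ ⟨x, rfl⟩
    suffices N.mkQ ∘ₗ indLift φ ρ τ f hf = 0 from
      (Submodule.Quotient.mk_eq_zero N).1 (LinearMap.congr_fun this x)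
    refine Representation.IndV.hom_ext φ ρ fun g => LinearMap.ext fun a => ?_
    change N.mkQ (indLift φ ρ τ f hf (Representation.IndV.mk φ ρ g a)) = 0
    rw [indLift_mk]
    exact (Submodule.Quotient.mk_eq_zero N).2 (hN _ _)
  · rintro _ ⟨g, a, rfl⟩
    exact ⟨Representation.IndV.mk φ ρ g⁻¹ a, by rw [indLift_mk, inv_inv]⟩

end Induced

/-! ### From abstract tensor products to functions on `Y^X × Z`, and back. -/

section TensorFun

theorem tensor_hom_ext {X κ U : Type*} [AddCommGroup U] [Module ℂ U] {h : X → κ}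
    {W : κ → Type*} [∀ k, AddCommGroup (W k)] [∀ k, Module ℂ (W k)]
    {M : Type*} [AddCommMonoid M] [Module ℂ M]
    {f g : ((⨂[ℂ] x, W (h x)) ⊗[ℂ] U) →ₗ[ℂ] M}
    (H : ∀ v u, f (PiTensorProduct.tprod ℂ v ⊗ₜ u) = g (PiTensorProduct.tprod ℂ v ⊗ₜ u)) :
    f = g :=
  TensorProduct.ext <| PiTensorProduct.ext <| MultilinearMap.ext fun v => LinearMap.ext fun u =>
    H v u

variable {X Y Z κ U : Type*} [Fintype X] [AddCommGroup U] [Module ℂ U]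
  {W : κ → Type*} [∀ k, AddCommGroup (W k)] [∀ k, Module ℂ (W k)]
  (j : ∀ k, W k →ₗ[ℂ] (Y → ℂ)) (h : X → κ)

/-- The map `⨂ W_{h(x)} → L(Y^X)` given by linear maps `W_k → L(Y)`. -/
def tensorEval : (⨂[ℂ] x, W (h x)) →ₗ[ℂ] ((X → Y) → ℂ) :=
  PiTensorProduct.lift <| MultilinearMap.pi fun φ =>
    (MultilinearMap.mkPiAlgebra ℂ X ℂ).compLinearMap fun x =>
      LinearMap.proj (φ x) ∘ₗ j (h x)

theorem tensorEval_tprod (v : ∀ x, W (h x)) (φ : X → Y) :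
    tensorEval j h (PiTensorProduct.tprod ℂ v) φ = ∏ x, j (h x) (v x) (φ x) := by
  simp [tensorEval]

/-- The map `⨂ W_{h(x)} ⊗ U → L(Y^X × Z)` given by a linear map `θ : U → L(Z)`. -/
def tensorFun (θ : U →ₗ[ℂ] (Z → ℂ)) :
    ((⨂[ℂ] x, W (h x)) ⊗[ℂ] U) →ₗ[ℂ] ((X → Y) × Z → ℂ) :=
  TensorProduct.lift <| LinearMap.mk₂ ℂ (fun t u p => tensorEval j h t p.1 * θ u p.2)
    (fun _ _ _ => by ext; simp [add_mul]) (fun _ _ _ => by ext; simp [mul_assoc])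
    (fun _ _ _ => by ext; simp [mul_add]) (fun _ _ _ => by ext; simp [mul_left_comm])

theorem tensorFun_tprod_tmul (θ : U →ₗ[ℂ] (Z → ℂ)) (v : ∀ x, W (h x)) (u : U) :
    tensorFun j h θ (PiTensorProduct.tprod ℂ v ⊗ₜ u) = pureFun (fun x => j (h x) (v x)) (θ u) := by
  ext p
  simp [tensorFun, tensorEval_tprod, pureFun_apply]

variable [Fintype Y] [Fintype Z] [DecidableEq X] [DecidableEq Y] [DecidableEq Z]

/-- The map `L(Y^X × Z) → ⨂ W_{h(x)} ⊗ U` given by maps `P k : L(Y) → W k` and `Q : L(Z) → U`. -/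
def tensorProj (P : ∀ k, (Y → ℂ) →ₗ[ℂ] W k) (Q : (Z → ℂ) →ₗ[ℂ] U) :
    ((X → Y) × Z → ℂ) →ₗ[ℂ] ((⨂[ℂ] x, W (h x)) ⊗[ℂ] U) :=
  ∑ p : (X → Y) × Z, (LinearMap.proj p).smulRight
    (PiTensorProduct.tprod ℂ (fun x => P (h x) (Pi.single (p.1 x) 1)) ⊗ₜ[ℂ] Q (Pi.single p.2 1))

theorem tensorProj_pureFun (P : ∀ k, (Y → ℂ) →ₗ[ℂ] W k) (Q : (Z → ℂ) →ₗ[ℂ] U)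
    (v : X → Y → ℂ) (b : Z → ℂ) : tensorProj h P Q (pureFun v b) =
      PiTensorProduct.tprod ℂ (fun x => P (h x) (v x)) ⊗ₜ[ℂ] Q b := by
  have h1 : PiTensorProduct.tprod ℂ (fun x => P (h x) (v x)) = ∑ φ : X → Y, (∏ x, v x (φ x)) •
      PiTensorProduct.tprod ℂ (fun x => P (h x) (Pi.single (φ x) 1)) := by
    have h2 : (fun x => P (h x) (v x)) =
        fun x => ∑ y, v x y • P (h x) (Pi.single y 1) := funext fun x => by
      conv_lhs => rw [LinearMap.pi_apply_eq_sum_univ (P (h x)) (v x)]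
      refine Finset.sum_congr rfl fun y _ => ?_
      congr 2
      ext y'
      simp [Pi.single_apply, eq_comm]
    rw [h2, MultilinearMap.map_sum]
    exact Finset.sum_congr rfl fun φ _ => MultilinearMap.map_smul_univ _ _ _
  have h3 : Q b = ∑ z, b z • Q (Pi.single z 1) := by
    conv_lhs => rw [LinearMap.pi_apply_eq_sum_univ Q b]
    refine Finset.sum_congr rfl fun y _ => ?_
    congr 2
    ext y'
    simp [Pi.single_apply, eq_comm]
  rw [h1, h3, TensorProduct.sum_tmul]
  simp only [TensorProduct.tmul_sum, TensorProduct.smul_tmul_smul, tensorProj,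
    LinearMap.sum_apply, Fintype.sum_prod_type]
  rfl

end TensorFun

/-! ### Equivalence of `W_i` with the induced representation. -/

section Equivalence

variable {F G X Y Z κ U₀ : Type*} [Group F] [Group G] [MulAction G X]
  [MulAction F Y] [MulAction G Z] [AddCommGroup U₀] [Module ℂ U₀]
  {W : κ → Type*} [∀ k, AddCommGroup (W k)] [∀ k, Module ℂ (W k)]

theorem linearMap_apply_cast {W : κ → Type*} [∀ k, AddCommGroup (W k)] [∀ k, Module ℂ (W k)]
    {M : Type*} [AddCommGroup M] [Module ℂ M] (j : ∀ k, W k →ₗ[ℂ] M) {k l : κ} (e : k = l)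
    (v : W k) : j l (cast (congrArg W e) v) = j k v := by
  subst e
  rfl

variable (σ : ∀ k, Representation ℂ F (W k)) (h : X → κ)
  (η : Representation ℂ (typeStabilizer G h) U₀)

theorem extension_tprod_tmul (k : wreathSubgroup F X (typeStabilizer G h))
    (v : ∀ x, W (h x)) (u : U₀) :
    ((extension σ h).tprod (inflation F X η)) k (PiTensorProduct.tprod ℂ v ⊗ₜ u) =
    PiTensorProduct.tprod ℂ (fun x => cast (congrArg W (wreathSubgroup_inv_smul k x))
      (σ (h (k.1.right⁻¹ • x)) (k.1.left x) (v (k.1.right⁻¹ • x)))) ⊗ₜ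
        η (wreathSubgroupProj F X _ k) u := by
  rw [Representation.tprod_apply, TensorProduct.map_tmul]
  congr 1
  exact extensionMap_tprod _ _ _ _

theorem tensorFun_equivariant [Fintype X] (j : ∀ k, W k →ₗ[ℂ] (Y → ℂ))
    (hj : ∀ k f w, j k (σ k f w) = permRep F Y f (j k w)) (θ : U₀ →ₗ[ℂ] (Z → ℂ))
    (hθ : ∀ g u, θ (η g u) = permRep G Z g (θ u))
    (k : wreathSubgroup F X (typeStabilizer G h)) (a : (⨂[ℂ] x, W (h x)) ⊗[ℂ] U₀) :
    tensorFun j h θ (((extension σ h).tprod (inflation F X η)) k a) =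
    permRep (WreathProduct F G X) ((X → Y) × Z) k.1 (tensorFun j h θ a) := by
  suffices tensorFun j h θ ∘ₗ (((extension σ h).tprod (inflation F X η)) k) =
      permRep (WreathProduct F G X) ((X → Y) × Z) k.1 ∘ₗ tensorFun j h θ from
    LinearMap.congr_fun this a
  refine tensor_hom_ext fun v u => ?_
  rw [LinearMap.comp_apply, LinearMap.comp_apply, extension_tprod_tmul, tensorFun_tprod_tmul,
    tensorFun_tprod_tmul, permRep_pureFun, hθ]
  congr 1
  funext x
  rw [linearMap_apply_cast j (wreathSubgroup_inv_smul k x), hj]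

end Equivalence

section EquivInduced

variable {F G X Y Z U₀ : Type*} [Group F] [Group G] [Fintype X] [MulAction G X]
  [MulAction F Y] [MulAction G Z] [AddCommGroup U₀] [Module ℂ U₀] {n : ℕ}
  {W : Fin n → Type*} [∀ k, AddCommGroup (W k)] [∀ k, Module ℂ (W k)]
  (V : Fin n → Subrepresentation (permRep F Y)) (σ : ∀ k, Representation ℂ F (W k))
  (j : ∀ k, W k →ₗ[ℂ] (Y → ℂ)) (h : X → Fin n)

theorem tensorFun_mem_wreathSubrep (hj : ∀ k, LinearMap.range (j k) = (V k).toSubmodule)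
    (B : Subrepresentation ((permRep G Z).comp (typeStabilizer G h).subtype))
    (θ : U₀ →ₗ[ℂ] (Z → ℂ)) (hθ : ∀ u, θ u ∈ B.toSubmodule)
    (a : (⨂[ℂ] x, W (h x)) ⊗[ℂ] U₀) :
    tensorFun j h θ a ∈ (wreathSubrep V h B).toSubmodule := by
  suffices ((wreathSubrep V h B).toSubmodule).mkQ ∘ₗ tensorFun j h θ = 0 from
    (Submodule.Quotient.mk_eq_zero _).1 (LinearMap.congr_fun this a)
  refine tensor_hom_ext fun v u => ?_
  refine (Submodule.Quotient.mk_eq_zero _).2 ?_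
  rw [tensorFun_tprod_tmul]
  refine Submodule.mem_iSup_of_mem 1 ?_
  have := pureFun_mem_translatedSummand (V := fun k => (V k).toSubmodule) (h := h) (s := (1 : G))
    (v := fun x => j (h x) (v x))
    (fun x => by rw [inv_one, one_smul, ← hj]; exact ⟨_, rfl⟩) (hθ u)
  rwa [map_one, Module.End.one_apply] at this

theorem wreathSubrep_le_span_tensorFun (hj : ∀ k, LinearMap.range (j k) = (V k).toSubmodule)
    (B : Subrepresentation ((permRep G Z).comp (typeStabilizer G h).subtype))
    (θ : U₀ →ₗ[ℂ] (Z → ℂ)) (hθ : ∀ b ∈ B.toSubmodule, ∃ u, θ u = b) :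
    (wreathSubrep V h B).toSubmodule ≤ Submodule.span ℂ {m | ∃ (w : WreathProduct F G X) (a : _),
      m = permRep (WreathProduct F G X) ((X → Y) × Z) w (tensorFun j h θ a)} := by
  refine iSup_le fun s => translatedSummand_le_iff.2 fun v hv b hb => Submodule.subset_span ?_
  obtain ⟨u, rfl⟩ := hθ b hb
  have hv' : ∀ x, ∃ w, j (h x) w = v (s • x) := fun x => by
    have := hv (s • x)
    rwa [inv_smul_smul, ← hj] at this
  choose w hw using hv'
  refine ⟨SemidirectProduct.inr s, PiTensorProduct.tprod ℂ w ⊗ₜ u, ?_⟩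
  rw [tensorFun_tprod_tmul, permRep_inr_pureFun]
  simp only [hw, smul_inv_smul]

/-- `R` is a tensor product of the projections to the `V k`, followed by left inverses of `j k`, and
a left inverse of `θ`. A translation that changes `h` at `x` puts a vector of the wrong constituent
in the factor `x`, which its projection kills. -/
theorem exists_tensorFun_leftInverse [DecidableEq X] [Fintype Y] [Finite Z]
    (hj : ∀ k, LinearMap.range (j k) = (V k).toSubmodule) (hjinj : ∀ k, Function.Injective (j k))
    (hV : DirectSum.IsInternal fun k => (V k).toSubmodule)
    (θ : U₀ →ₗ[ℂ] (Z → ℂ)) (hθ : Function.Injective θ) :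
    ∃ R : ((X → Y) × Z → ℂ) →ₗ[ℂ] ((⨂[ℂ] x, W (h x)) ⊗[ℂ] U₀),
      (∀ a, R (tensorFun j h θ a) = a) ∧
      ∀ g : G, (∃ x, h (g⁻¹ • x) ≠ h x) → ∀ a,
        R (permRep (WreathProduct F G X) ((X → Y) × Z) (SemidirectProduct.inr g)
          (tensorFun j h θ a)) = 0 := by
  classical
  have := Fintype.ofFinite Z
  obtain ⟨Q, hQ⟩ := θ.exists_leftInverse_of_injective (LinearMap.ker_eq_bot.2 hθ)
  obtain ⟨p, hp, hpsame, hpne, -, -⟩ := exists_equivariant_projections V hV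
  choose q hq using fun k =>
    (j k).exists_leftInverse_of_injective (LinearMap.ker_eq_bot.2 (hjinj k))
  let P : ∀ k, (Y → ℂ) →ₗ[ℂ] W k := fun k => q k ∘ₗ p k
  have hjmem : ∀ k w, j k w ∈ (V k).toSubmodule := fun k w => hj k ▸ ⟨w, rfl⟩
  have hPsame : ∀ k w, P k (j k w) = w := fun k w => by
    rw [LinearMap.comp_apply, hpsame k _ (hjmem k w)]
    exact LinearMap.congr_fun (hq k) w
  have hPne : ∀ k l, k ≠ l → ∀ w, P k (j l w) = 0 := fun k l hkl w => by
    rw [LinearMap.comp_apply, hpne k l hkl _ (hjmem l w), map_zero]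
  refine ⟨tensorProj h P Q, fun a => ?_, fun g ⟨x, hx⟩ a => ?_⟩
  · suffices tensorProj h P Q ∘ₗ tensorFun j h θ = LinearMap.id from LinearMap.congr_fun this a
    refine tensor_hom_ext fun v u => ?_
    rw [LinearMap.comp_apply, tensorFun_tprod_tmul, tensorProj_pureFun, LinearMap.id_apply,
      show Q (θ u) = u from LinearMap.congr_fun hQ u]
    simp only [hPsame]
  · suffices tensorProj h P Q ∘ₗ
        permRep (WreathProduct F G X) ((X → Y) × Z) (SemidirectProduct.inr g) ∘ₗ
        tensorFun j h θ = 0 from LinearMap.congr_fun this a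
    refine tensor_hom_ext fun v u => ?_
    rw [LinearMap.comp_apply, LinearMap.comp_apply, tensorFun_tprod_tmul, permRep_inr_pureFun,
      tensorProj_pureFun, LinearMap.zero_apply,
      MultilinearMap.map_coord_zero _ x (hPne _ _ hx.symm _), TensorProduct.zero_tmul]

theorem nonempty_wreathSubrep_equiv_inducedRep [DecidableEq X] [Fintype Y] [Finite Z] [Finite G]
    (hσ : ∀ k f w, j k (σ k f w) = permRep F Y f (j k w))
    (hj : ∀ k, LinearMap.range (j k) = (V k).toSubmodule) (hjinj : ∀ k, Function.Injective (j k))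
    (hV : DirectSum.IsInternal fun k => (V k).toSubmodule)
    (η : Representation ℂ (typeStabilizer G h) U₀)
    (B : Subrepresentation ((permRep G Z).comp (typeStabilizer G h).subtype))
    (hB : Nonempty (B.toRepresentation.Equiv η))
    {S : Set G} (hS : Subgroup.IsComplement S (typeStabilizer G h : Set G)) :
    Nonempty ((wreathSubrep (X := X) V h B).toRepresentation.Equiv (inducedRep σ h η)) := by
  have := Fintype.ofFinite S
  obtain ⟨e⟩ := hB
  obtain ⟨θ, hθ, hθB, hBθ, hinj⟩ : ∃ θ : U₀ →ₗ[ℂ] (Z → ℂ),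
      (∀ g u, θ (η g u) = permRep G Z g (θ u)) ∧ (∀ u, θ u ∈ B.toSubmodule) ∧
      (∀ b ∈ B.toSubmodule, ∃ u, θ u = b) ∧ Function.Injective θ :=
    ⟨B.toSubmodule.subtype ∘ₗ e.toLinearEquiv.symm.toLinearMap, fun g u =>
      congrArg Subtype.val (e.symm.toIntertwiningMap.isIntertwining _ _ g u),
      fun u => Subtype.mem _, fun b hb => ⟨e.toLinearEquiv ⟨b, hb⟩,
      congrArg Subtype.val (e.toLinearEquiv.symm_apply_apply ⟨b, hb⟩)⟩,
      Subtype.val_injective.comp e.toLinearEquiv.symm.injective⟩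
  obtain ⟨R, hR, hR'⟩ := exists_tensorFun_leftInverse (F := F) (G := G) V j h hj hjinj hV θ hinj
  have hΦ := tensorFun_equivariant σ h η j hσ θ hθ
  have hcover : ∀ w : WreathProduct F G X, ∃ (s : S)
      (k : wreathSubgroup F X (typeStabilizer G h)), w = SemidirectProduct.inr s.1 *
        (wreathSubgroup F X (typeStabilizer G h)).subtype k := fun w => by
    obtain ⟨⟨⟨s, hs⟩, ⟨i, hi⟩⟩, hsi⟩ := hS.2 w.right
    dsimp only at hsi
    refine ⟨⟨s, hs⟩, ⟨(SemidirectProduct.inr s)⁻¹ * w, ?_⟩, (mul_inv_cancel_left _ _).symm⟩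
    change ((SemidirectProduct.inr s : WreathProduct F G X)⁻¹ * w).right ∈ typeStabilizer G h
    rw [SemidirectProduct.mul_right, SemidirectProduct.inv_right, SemidirectProduct.right_inr,
      ← hsi, inv_mul_cancel_left]
    exact hi
  have hinj' := indLift_injective (wreathSubgroup F X (typeStabilizer G h)).subtype
    ((extension σ h).tprod (inflation F X η))
    (permRep (WreathProduct F G X) ((X → Y) × Z)) (tensorFun j h θ) hΦ
    (fun s : S => SemidirectProduct.inr s.1) hcover R
    (fun s a => by rw [permRep_inv_apply_self, hR])
    (fun s t hst a => by
      rw [← permRep_mul_apply, ← map_inv, ← map_mul]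
      refine hR' _ ?_ a
      obtain ⟨x, hx⟩ := exists_ne_of_isComplement hS s.2 t.2 fun he => hst (Subtype.ext he)
      refine ⟨s.1⁻¹ • x, ?_⟩
      rw [mul_inv_rev, inv_inv, mul_smul, smul_inv_smul]
      exact hx.symm)
  have hrange := range_indLift (wreathSubgroup F X (typeStabilizer G h)).subtype
    ((extension σ h).tprod (inflation F X η))
    (permRep (WreathProduct F G X) ((X → Y) × Z)) (tensorFun j h θ) hΦ
    (wreathSubrep V h B).toSubmodule
    (fun w a => Subrepresentation.apply_mem_toSubmodule _ w
      (tensorFun_mem_wreathSubrep V j h hj B θ hθB a))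
    (wreathSubrep_le_span_tensorFun V j h hj B θ hBθ)
  exact nonempty_equiv_of_injective _ _ (indLift_ind _ _ _ _ hΦ) hinj' hrange

end EquivInduced

/-! ### The action of `F^X` and of `I` on `σ̃ ⊗ η̄`. -/

section Isotypic

theorem indV_mk_one_rep {G H A : Type*} [Group G] [Group H] [AddCommGroup A] [Module ℂ A]
    (φ : H →* G) (ρ : Representation ℂ H A) (k : H) (a : A) :
    Representation.IndV.mk φ ρ 1 (ρ k a) =
      Representation.ind φ ρ (φ k) (Representation.IndV.mk φ ρ 1 a) := by
  rw [Representation.ind_mk, one_mul, ← indV_mk_mul φ ρ (φ k)⁻¹ k a, mul_inv_cancel]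

theorem contract_permRep_inr {F G X Y Z : Type*} [Group F] [Group G] [Fintype X] [DecidableEq X]
    [MulAction G X] [MulAction F Y] [MulAction G Z] [Fintype Y] [Finite Z]
    (g : G) (v : X → Y → ℂ) (m : (X → Y) × Z → ℂ) :
    contract v (permRep (WreathProduct F G X) ((X → Y) × Z) (SemidirectProduct.inr g) m) =
      permRep G Z g (contract (fun x => v (g • x)) m) := by
  suffices contract v ∘ₗ permRep (WreathProduct F G X) ((X → Y) × Z) (SemidirectProduct.inr g) =
      permRep G Z g ∘ₗ contract (fun x => v (g • x)) from LinearMap.congr_fun this m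
  refine linearMap_ext_pureFun fun u b => ?_
  rw [LinearMap.comp_apply, LinearMap.comp_apply, permRep_inr_pureFun, contract_pureFun,
    contract_pureFun, map_smul, ← Equiv.prod_comp (MulAction.toPerm g)]
  simp only [MulAction.toPerm_apply, inv_smul_smul]

theorem inl_mem_wreathSubgroup {F G X : Type*} [Group F] [Group G] [MulAction G X]
    (I : Subgroup G) (f : X → F) :
    (SemidirectProduct.inl f : WreathProduct F G X) ∈ wreathSubgroup F X I := by
  change (SemidirectProduct.inl f : WreathProduct F G X).right ∈ I
  rw [SemidirectProduct.right_inl]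
  exact I.one_mem

theorem inr_mem_wreathSubgroup {F G X : Type*} [Group F] [Group G] [MulAction G X]
    (I : Subgroup G) (g : I) :
    (SemidirectProduct.inr g.1 : WreathProduct F G X) ∈ wreathSubgroup F X I := g.2

variable {F G X U₀ κ : Type*} [Group F] [Group G] [MulAction G X]
  [AddCommGroup U₀] [Module ℂ U₀]
  {W : κ → Type*} [∀ k, AddCommGroup (W k)] [∀ k, Module ℂ (W k)]
  (σ : ∀ k, Representation ℂ F (W k)) (h : X → κ)
  (η : Representation ℂ (typeStabilizer G h) U₀)

theorem extension_inl_tprod_tmul (f : X → F) (v : ∀ x, W (h x)) (u : U₀) :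
    ((extension σ h).tprod (inflation F X η))
        ⟨SemidirectProduct.inl f, inl_mem_wreathSubgroup _ f⟩ (PiTensorProduct.tprod ℂ v ⊗ₜ u) =
      PiTensorProduct.tprod ℂ (fun x => σ (h x) (f x) (v x)) ⊗ₜ u := by
  rw [extension_tprod_tmul]
  congr 1
  · congr 1
    funext x
    exact cast_rep_congr σ v (y := (1 : G)⁻¹ • x) (by simp) (by simp) rfl _
  · have : wreathSubgroupProj F X (typeStabilizer G h)
        ⟨SemidirectProduct.inl f, inl_mem_wreathSubgroup _ f⟩ = 1 := rfl
    rw [this, map_one, Module.End.one_apply]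

/-- When the vector in position `x` depends only on `h x`, the permutation by `g ∈ I` leaves the
tensor unchanged and only `η` acts. -/
theorem extension_inr_tprod_tmul (g : typeStabilizer G h) (v : ∀ k, W k) (u : U₀) :
    ((extension σ h).tprod (inflation F X η))
        ⟨SemidirectProduct.inr g.1, inr_mem_wreathSubgroup _ g⟩
        (PiTensorProduct.tprod ℂ (fun x => v (h x)) ⊗ₜ u) =
      PiTensorProduct.tprod ℂ (fun x => v (h x)) ⊗ₜ η g u := by
  have hv : ∀ {k l : κ} (e : k = l), cast (congrArg W e) (σ k 1 (v k)) = v l := by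
    rintro k _ rfl
    rw [map_one]
    rfl
  rw [extension_tprod_tmul]
  congr 1
  congr 1
  funext x
  exact hv (wreathSubgroup_inv_smul
    ⟨SemidirectProduct.inr g.1, inr_mem_wreathSubgroup (F := F) _ g⟩ x)

theorem sum_extension_inl [Fintype X] [DecidableEq X] [Fintype F] {v w : ∀ x, W (h x)}
    {α : X → F → ℂ} {c : X → ℂ}
    (hα : ∀ x, ∑ g, α x g • σ (h x) g (v x) = c x • w x) (u : U₀) :
    ∑ f : X → F, (∏ x, α x (f x)) • ((extension σ h).tprod (inflation F X η))
        ⟨SemidirectProduct.inl f, inl_mem_wreathSubgroup _ f⟩ (PiTensorProduct.tprod ℂ v ⊗ₜ u) =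
      (∏ x, c x) • (PiTensorProduct.tprod ℂ w ⊗ₜ u) := by
  rw [TensorProduct.smul_tmul', ← MultilinearMap.map_smul_univ,
    show (fun x => c x • w x) = _ from funext fun x => (hα x).symm, MultilinearMap.map_sum,
    TensorProduct.sum_tmul]
  refine Finset.sum_congr rfl fun f _ => ?_
  rw [extension_inl_tprod_tmul, MultilinearMap.map_smul_univ, TensorProduct.smul_tmul']

end Isotypic

/-! ### The isotypic component of the induced representation. -/

section IsotypicPart

variable {F G X Y Z U₀ : Type*} [Group F] [Finite F] [Group G] [Fintype X] [MulAction G X]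
  [DecidableEq X] [MulAction F Y] [MulAction G Z] [AddCommGroup U₀] [Module ℂ U₀] [Fintype Y]
  [Finite Z] {n : ℕ}
  {W : Fin n → Type*} [∀ k, AddCommGroup (W k)] [∀ k, Module ℂ (W k)]

/-- A group algebra element of `F^X` carrying `e ⊗ u` to a nonzero multiple of `w ⊗ u` commutes with
`T`; on the target it contracts with `e` and tensors with `w`. Hence `T (w ⊗ u)` is `w` tensored
with a multiple of `T₀ u`, where `T₀` does not depend on `w`. -/
theorem equivariant_map_mem (V : Fin n → Subrepresentation (permRep F Y))
    (hV : IsIrreducibleDecomposition (permRep F Y) V)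
    (hVne : ∀ i j, i ≠ j →
      ¬ Nonempty ((V i).toRepresentation.Equiv (V j).toRepresentation))
    (σ : ∀ k, Representation ℂ F (W k)) (j : ∀ k, W k →ₗ[ℂ] (Y → ℂ))
    (hσ : ∀ k f w, j k (σ k f w) = permRep F Y f (j k w))
    (hj : ∀ k, LinearMap.range (j k) = (V k).toSubmodule) (hjinj : ∀ k, Function.Injective (j k))
    (h : X → Fin n) (η : Representation ℂ (typeStabilizer G h) U₀) (hη : η.IsIrreducible)
    (T : ((⨂[ℂ] x, W (h x)) ⊗[ℂ] U₀) →ₗ[ℂ] ((X → Y) × Z → ℂ))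
    (hT : ∀ k a, T (((extension σ h).tprod (inflation F X η)) k a) =
        permRep (WreathProduct F G X) ((X → Y) × Z) k.1 (T a))
    (w : ∀ x, W (h x)) (u : U₀) :
    ∃ c ∈ isotypicPart ((permRep G Z).comp (typeStabilizer G h).subtype) η,
      T (PiTensorProduct.tprod ℂ w ⊗ₜ u) = pureFun (fun x => j (h x) (w x)) c := by
  have := Fintype.ofFinite F
  have hjmem : ∀ k w, j k w ∈ (V k).toSubmodule := fun k w => hj k ▸ ⟨w, rfl⟩
  have he : ∀ k, ∃ e : W k, j k e ≠ 0 := fun k => by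
    obtain ⟨x, hx, hx0⟩ := exists_mem_ne_zero_of_isIrreducible (V k) (hV.1 k)
    rw [← hj] at hx
    obtain ⟨e, rfl⟩ := hx
    exact ⟨e, hx0⟩
  choose e he0 using he
  -- The vectors `e k` are chosen once per constituent, not per point `x`, so that `I` fixes their
  -- tensor product and `T₀` intertwines `η` with `L(Z)`.
  let T₀ : U₀ →ₗ[ℂ] (Z → ℂ) := contract (fun x => j (h x) (e (h x))) ∘ₗ T ∘ₗ
    TensorProduct.mk ℂ _ _ (PiTensorProduct.tprod ℂ fun x => e (h x))
  have hT₀ : ∀ u, T₀ u = contract (fun x => j (h x) (e (h x)))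
      (T (PiTensorProduct.tprod ℂ (fun x => e (h x)) ⊗ₜ u)) := fun _ => rfl
  have hequiv : ∀ g u, T₀ (η g u) =
      ((permRep G Z).comp (typeStabilizer G h).subtype) g (T₀ u) := fun g u => by
    rw [hT₀, hT₀, ← extension_inr_tprod_tmul σ h η g e u, hT]
    have hg : (fun x => j (h (g.1 • x)) (e (h (g.1 • x)))) = fun x => j (h x) (e (h x)) :=
      funext fun x => by rw [g.2 x]
    refine (contract_permRep_inr _ _ _).trans ?_
    rw [hg]
    rfl
  have hiso := range_le_isotypicPart hη T₀ hequiv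
  choose α hα using fun x => exists_groupAlgebra_rankOne V hV hVne (h x) (hjmem _ (w x))
    (hjmem _ (e (h x)))
  have hα' : ∀ x, ∑ g, α x g • σ (h x) g (e (h x)) =
      (j (h x) (e (h x)) ⬝ᵥ star (j (h x) (e (h x)))) • w x := fun x => hjinj _ <| by
    rw [map_smul, ← hα, map_sum]
    simp only [map_smul, hσ]
  set c : ℂ := ∏ x, j (h x) (e (h x)) ⬝ᵥ star (j (h x) (e (h x))) with hc
  have hc0 : c ≠ 0 := Finset.prod_ne_zero_iff.2 fun x _ hx =>
    he0 _ (eq_zero_of_dotProduct_star hx)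
  have key : pureFun (fun x => j (h x) (w x)) (T₀ u) = c • T (PiTensorProduct.tprod ℂ w ⊗ₜ u) := by
    rw [hT₀, ← sum_groupAlgebra_permRep (G := G) hα, ← map_smul, hc,
      ← sum_extension_inl σ h η hα' u, map_sum]
    refine Finset.sum_congr rfl fun f _ => ?_
    rw [map_smul, hT]
  refine ⟨c⁻¹ • T₀ u, Submodule.smul_mem _ _ (hiso ⟨u, rfl⟩), ?_⟩
  rw [← pureFunHom_apply, map_smul, pureFunHom_apply, key, smul_smul, inv_mul_cancel₀ hc0, one_smul]

/-- An embedding of the induced representation is determined by its values on the classes `[1, a]`;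
`equivariant_map_mem` puts these into the sum of the `W_i`, and invariance of the sum does the rest.
-/
theorem le_iSup_wreathSubrep_of_equiv (V : Fin n → Subrepresentation (permRep F Y))
    (hV : IsIrreducibleDecomposition (permRep F Y) V)
    (hVne : ∀ i j, i ≠ j →
      ¬ Nonempty ((V i).toRepresentation.Equiv (V j).toRepresentation))
    (σ : ∀ k, Representation ℂ F (W k)) (j : ∀ k, W k →ₗ[ℂ] (Y → ℂ))
    (hσ : ∀ k f w, j k (σ k f w) = permRep F Y f (j k w))
    (hj : ∀ k, LinearMap.range (j k) = (V k).toSubmodule) (hjinj : ∀ k, Function.Injective (j k))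
    (h : X → Fin n) (η : Representation ℂ (typeStabilizer G h) U₀) (hη : η.IsIrreducible)
    {ι : Type*} (U : ι → Subrepresentation ((permRep G Z).comp (typeStabilizer G h).subtype))
    (hU : isotypicPart ((permRep G Z).comp (typeStabilizer G h).subtype) η ≤
      ⨆ i, (U i).toSubmodule)
    (A : Subrepresentation (permRep (WreathProduct F G X) ((X → Y) × Z)))
    (hA : Nonempty (A.toRepresentation.Equiv (inducedRep σ h η))) :
    A.toSubmodule ≤ ⨆ i, (wreathSubrep V h (U i)).toSubmodule := by
  obtain ⟨e⟩ := hA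
  set N := ⨆ i, (wreathSubrep (X := X) V h (U i)).toSubmodule with hN
  have hNinv : ∀ (w : WreathProduct F G X), ∀ m ∈ N, permRep _ ((X → Y) × Z) w m ∈ N := by
    intro w m hm
    suffices hle : N ≤ N.comap (permRep (WreathProduct F G X) ((X → Y) × Z) w) from hle hm
    exact iSup_le fun i m hm => Submodule.mem_iSup_of_mem i
      ((wreathSubrep V h (U i)).apply_mem_toSubmodule w hm)
  have hpure : ∀ v : X → Y → ℂ, (∀ x, v x ∈ (V (h x)).toSubmodule) →
      ∀ c ∈ isotypicPart ((permRep G Z).comp (typeStabilizer G h).subtype) η,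
        pureFun v c ∈ N := by
    intro v hv c hc
    suffices hle : ⨆ i, (U i).toSubmodule ≤ N.comap (pureFunHom v) from hle (hU hc)
    refine iSup_le fun i b hb => Submodule.mem_iSup_of_mem i (Submodule.mem_iSup_of_mem 1 ?_)
    have := pureFun_mem_translatedSummand (V := fun k => (V k).toSubmodule) (h := h) (s := (1 : G))
      (v := v) (fun x => by rw [inv_one, one_smul]; exact hv x) hb
    rwa [map_one, Module.End.one_apply] at this
  let ρ := (extension σ h).tprod (inflation F X η)
  let φ := (wreathSubgroup F X (typeStabilizer G h)).subtype
  let E : Representation.IndV φ ρ →ₗ[ℂ] ((X → Y) × Z → ℂ) :=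
    A.toSubmodule.subtype ∘ₗ e.toLinearEquiv.symm.toLinearMap
  have hE : ∀ w x, E (Representation.ind φ ρ w x) =
      permRep (WreathProduct F G X) ((X → Y) × Z) w (E x) := fun w x =>
    congrArg Subtype.val (e.symm.toIntertwiningMap.isIntertwining _ _ w x)
  have hTN : ∀ a, E (Representation.IndV.mk φ ρ 1 a) ∈ N := by
    intro a
    suffices N.mkQ ∘ₗ E ∘ₗ Representation.IndV.mk φ ρ 1 = 0 from
      (Submodule.Quotient.mk_eq_zero _).1 (LinearMap.congr_fun this a)
    refine tensor_hom_ext fun w u => ?_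
    refine (Submodule.Quotient.mk_eq_zero _).2 ?_
    obtain ⟨c, hc, hcT⟩ := equivariant_map_mem V hV hVne σ j hσ hj hjinj h η hη
      (E ∘ₗ Representation.IndV.mk φ ρ 1) (fun k a => by
        change E (Representation.IndV.mk φ ρ 1 (ρ k a)) = _
        rw [indV_mk_one_rep, hE]
        rfl) w u
    have h1 := hpure (fun x => j (h x) (w x))
      (fun x => hj (h x) ▸ LinearMap.mem_range_self _ _) c hc
    rw [← hcT] at h1
    exact h1
  have hEN : N.mkQ ∘ₗ E = 0 := by
    refine Representation.IndV.hom_ext φ ρ fun g => LinearMap.ext fun a => ?_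
    refine (Submodule.Quotient.mk_eq_zero _).2 ?_
    have h1 := hNinv g⁻¹ _ (hTN a)
    rwa [← hE, Representation.ind_mk, inv_inv, one_mul] at h1
  intro x hx
  have h1 : E (e.toLinearEquiv ⟨x, hx⟩) = x :=
    congrArg Subtype.val (e.toLinearEquiv.symm_apply_apply ⟨x, hx⟩)
  rw [← h1]
  exact (Submodule.Quotient.mk_eq_zero _).1 (LinearMap.congr_fun hEN _)

end IsotypicPart

end

theorem mainTheorem10
    {F G X Y Z : Type*} [Group F] [Finite F] [Group G] [Finite G]
    [Fintype X] [DecidableEq X] [Nonempty X] [Fintype Y] [Nonempty Y] [Fintype Z] [Nonempty Z]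
    [MulAction G X] [MulAction.IsPretransitive G X]
    [MulAction F Y] [MulAction.IsPretransitive F Y]
    [MulAction G Z] [MulAction.IsPretransitive G Z]
    -- `L(Y) = V_0 ⊕ ⋯ ⊕ V_n` with irreducible, pairwise inequivalent summands
    {n : ℕ} (V : Fin (n + 1) → Subrepresentation (permRep F Y))
    (hV : IsIrreducibleDecomposition (permRep F Y) V)
    (hVne : ∀ i j, i ≠ j →
      ¬ Nonempty ((V i).toRepresentation.Equiv (V j).toRepresentation))
    (h : X → Fin (n + 1))
    -- an irreducible representation `η` of the stabilizer `I` of `h`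
    {U₀ : Type*} [AddCommGroup U₀] [Module ℂ U₀]
    (η : Representation ℂ (typeStabilizer G h) U₀) (hη : η.IsIrreducible)
    -- an orthogonal decomposition of the `η`-isotypic component of `L(Z)`
    {m : ℕ} (U : Fin m → Subrepresentation ((permRep G Z).comp (typeStabilizer G h).subtype))
    (hU : IsOrthogonalIsotypicDecomposition _ η U)
    -- representatives of the cosets `s I`
    (S : Set G) (hS : Subgroup.IsComplement S (typeStabilizer G h : Set G)) :
    (∀ i, ∀ s ∈ S, ∀ t ∈ S, s ≠ t →
      OrthogonalSubspaces
        (translatedSummand (fun k => (V k).toSubmodule) h (U i).toSubmodule s)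
        (translatedSummand (fun k => (V k).toSubmodule) h (U i).toSubmodule t)) ∧
    (∃ W : Fin m → Subrepresentation (permRep (WreathProduct F G X) ((X → Y) × Z)),
      (∀ i, (W i).toSubmodule =
        ⨆ s ∈ S, translatedSummand (fun k => (V k).toSubmodule) h (U i).toSubmodule s) ∧
      IsOrthogonalIsotypicDecomposition _
        (inducedRep (F := F) (fun k => (V k).toRepresentation) h η) W) ∧
    HasMultiplicity ((permRep G Z).comp (typeStabilizer G h).subtype) η m ∧
    HasMultiplicity (permRep (WreathProduct F G X) ((X → Y) × Z))
      (inducedRep (F := F) (fun k => (V k).toRepresentation) h η) m := by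
  classical
  have hO : ∀ i j, i ≠ j → OrthogonalSubspaces (V i).toSubmodule (V j).toSubmodule :=
    fun i j hij => orthogonalSubspaces_of_not_equiv _ _ (hV.1 i) (hV.1 j) (hVne i j hij)
  have hσ : ∀ k f (w : (V k).toSubmodule), (V k).toSubmodule.subtype
      ((V k).toRepresentation f w) = permRep F Y f ((V k).toSubmodule.subtype w) :=
    fun _ _ _ => rfl
  have hequiv := fun i => nonempty_wreathSubrep_equiv_inducedRep V
    (fun k => (V k).toRepresentation) (fun k => (V k).toSubmodule.subtype) h hσ
    (fun k => (V k).toSubmodule.range_subtype) (fun k => (V k).toSubmodule.injective_subtype)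
    hV.2 η (U i) (hU.2.1 i) hS
  have hW : IsOrthogonalIsotypicDecomposition _
      (inducedRep (F := F) (fun k => (V k).toRepresentation) h η)
      fun i => wreathSubrep V h (U i) :=
    ⟨fun i => isIrreducible_wreathSubrep V h hV hVne (U i) (hU.1 i), hequiv,
      fun i j hij => orthogonalSubspaces_wreathSubrep V h hO _ _ (hU.2.2.1 i j hij),
      le_antisymm (iSup_le_isotypicPart _ hequiv) (iSup₂_le fun A hA =>
        le_iSup_wreathSubrep_of_equiv V hV hVne _ (fun k => (V k).toSubmodule.subtype) hσ
          (fun k => (V k).toSubmodule.range_subtype) (fun k => (V k).toSubmodule.injective_subtype)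
          h η hη U hU.2.2.2.ge A hA)⟩
  have hfin : Finite (WreathProduct F G X) :=
    Finite.of_equiv _ SemidirectProduct.equivProd.symm
  refine ⟨fun i s hs t ht hst => ?_, ⟨fun i => wreathSubrep V h (U i), fun i =>
    (iSup_translatedSummand_eq V h (U i) hS).symm, hW⟩, hU.hasMultiplicity, hW.hasMultiplicity⟩
  obtain ⟨x, hx⟩ := exists_ne_of_isComplement hS hs ht hst
  exact orthogonalSubspaces_translatedSummand_of_ne hO _ _ hx
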